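/- Let $k,n\ge 1$ be integers and let $M$ be a smooth Hausdorff manifold. An $\mathbb{R}^k$-valued one-form $\boldsymbol\eta$ on an open set $U\subset M$ is a *$k$-contact form* if $\ker\boldsymbol\eta$ is a regular non-zero distribution of corank $k$, $\ker \mathrm{d}\boldsymbol\eta=\{v : \mathrm{d}\boldsymbol\eta(v,\cdot)=0\}$ is a regular distribution of rank $k$, and $\ker\boldsymbol\eta\cap\ker\mathrm{d}\boldsymbol\eta=0$. A distribution $\mathcal D\subset \mathrm{T}M$ is a *$k$-contact distribution* if every point of $M$ has an open neighbourhood $U$ carrying a $k$-contact form $\boldsymbol\eta$ with $\mathcal D|_U=\ker\boldsymbol\eta$. A *polarised $k$-contact manifold* is a triple $(M,\mathcal D,\mathcal V)$ where $\mathcal D$ is a $k$-contact distribution on $M$, $\dim M=(n+1)(k+1)-1$, and $\mathcal V$ is an integrable subbundle of $\mathcal D$ of rank $nk$ (integrable: tangent to a foliation). For a smooth fibre bundle $\pi\colon E\to N$, let $J^1(N,E)$ be the manifold of first-order jets of its local sections, i.e. of pairs $(e,L)$ with $e\in E$ and $L\colon \mathrm{T}_{\pi(e)}N\to \mathrm{T}_eE$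 a linear right inverse of $\mathrm{T}_e\pi$; let $\pi^1_0\colon J^1(N,E)\to E$, $(e,L)\mapsto e$, and let the Cartan distribution be $\mathcal C_{(e,L)}=(\mathrm{T}_{(e,L)}\pi^1_0)^{-1}(\operatorname{im}L)$. **Theorem.** Let $(M,\mathcal D,\mathcal V)$ be a polarised $k$-contact manifold of dimension $(n+1)(k+1)-1$. Then there is a smooth fibre bundle $E\to N$ of rank $k$ (fibres of dimension $k$) over an $n$-dimensional manifold $N$, with $N$, $E$ and the typical fibre connected, Hausdorff and second countable, such that $M$ is locally diffeomorphic to $J^1(N,E)$ as a polarised $k$-contact manifold: every point of $M$ has an open neighbourhood $U$ and a diffeomorphism $\Phi$ from $U$ onto an open subset of $J^1(N,E)$ such that, for all $y\in U$ and $v\in \mathrm{T}_yM$, $$v\in\mathcal D_y\iff \mathrm{T}_y\Phi(v)\in\mathcal C_{\Phi(y)},\qquad v\in\mathcal V_y\iff \mathrm{T}_y\Phi(v)\in\ker \mathrm{T}_{\Phi(y)}\pi^1_0 .$$ -/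

import Mathlib

open Set Topology Manifold ContDiff Bundle

noncomputable section

/-! ### Distributions and `ℝᵏ`-valued one-forms on an `m`-dimensional manifold -/

section Distributions

variable {m : ℕ} {M : Type*} [TopologicalSpace M] [ChartedSpace (EuclideanSpace ℝ (Fin m)) M]

/-- A (possibly non-regular) distribution: a linear subspace of every tangent space. -/
abbrev TangentDistribution (m : ℕ) (M : Type*) [TopologicalSpace M]
    [ChartedSpace (EuclideanSpace ℝ (Fin m)) M] : Type _ :=
  ∀ x : M, Submodule ℝ (TangentSpace (𝓡 m) x)

/-- The vector field `X` is smooth on `U`. -/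
def IsSmoothVectorFieldOn [IsManifold (𝓡 m) ∞ M]
    (X : ∀ x : M, TangentSpace (𝓡 m) x) (U : Set M) : Prop :=
  ContMDiffOn (𝓡 m) (𝓡 m).tangent ∞ (fun x => (⟨x, X x⟩ : TangentBundle (𝓡 m) M)) U

/-- `D` is regular of rank `r` on the open set `U`: it has constant rank `r` there and it is
smooth, i.e. locally spanned by a finite family of smooth vector fields. -/
structure IsRegularOn [IsManifold (𝓡 m) ∞ M]
    (D : TangentDistribution m M) (U : Set M) (r : ℕ) : Prop where
  rank_eq : ∀ x ∈ U, Module.finrank ℝ (D x) = r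
  smooth : ∀ x ∈ U, ∃ W : Set M, IsOpen W ∧ x ∈ W ∧ W ⊆ U ∧
    ∃ (s : ℕ) (X : Fin s → ∀ y : M, TangentSpace (𝓡 m) y),
      (∀ i, IsSmoothVectorFieldOn (X i) W) ∧
      ∀ y ∈ W, D y = Submodule.span ℝ (range fun i => X i y)

/-- `V` is integrable: it is the tangent distribution of a foliation. That is, around every point
there is a chart of the smooth atlas in which `V` is a constant distribution `W`, so that the
slices of the chart parallel to `W` are integral manifolds of `V`. -/
def IsIntegrable [IsManifold (𝓡 m) ∞ M] (V : TangentDistribution m M) : Prop :=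
  ∀ x : M, ∃ φ ∈ IsManifold.maximalAtlas (𝓡 m) ∞ M, x ∈ φ.source ∧
    ∃ W : Submodule ℝ (EuclideanSpace ℝ (Fin m)), ∀ y ∈ φ.source, ∀ v : TangentSpace (𝓡 m) y,
      v ∈ V y ↔ mfderiv (𝓡 m) (𝓡 m) φ y v ∈ W

/-- An `ℝᵏ`-valued one-form (not necessarily smooth). -/
abbrev VectorOneForm (m k : ℕ) (M : Type*) [TopologicalSpace M]
    [ChartedSpace (EuclideanSpace ℝ (Fin m)) M] : Type _ :=
  ∀ x : M, TangentSpace (𝓡 m) x →L[ℝ] Bundle.Trivial M (EuclideanSpace ℝ (Fin k)) x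

variable {k : ℕ}

/-- The one-form `η` is smooth on `U`, as a section of the bundle `Hom(TM, M × ℝᵏ)`. -/
def VectorOneForm.IsSmoothOn [IsManifold (𝓡 m) ∞ M] (η : VectorOneForm m k M) (U : Set M) : Prop :=
  ContMDiffOn (𝓡 m)
    ((𝓡 m).prod 𝓘(ℝ, EuclideanSpace ℝ (Fin m) →L[ℝ] EuclideanSpace ℝ (Fin k))) ∞
    (fun x => TotalSpace.mk' (EuclideanSpace ℝ (Fin m) →L[ℝ] EuclideanSpace ℝ (Fin k))
      (E := fun x : M =>
        TangentSpace (𝓡 m) x →L[ℝ] Bundle.Trivial M (EuclideanSpace ℝ (Fin k)) x) x (η x)) U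

/-- The expression of `η` in the preferred chart at `x`, i.e. its pullback by the inverse chart. -/
def VectorOneForm.inChart (η : VectorOneForm m k M) (x : M) (z : EuclideanSpace ℝ (Fin m)) :
    EuclideanSpace ℝ (Fin m) →L[ℝ] EuclideanSpace ℝ (Fin k) :=
  (η ((chartAt (EuclideanSpace ℝ (Fin m)) x).symm z)).comp
    (mfderiv (𝓡 m) (𝓡 m) (chartAt (EuclideanSpace ℝ (Fin m)) x).symm z)

/-- The exterior derivative `(dη)ₓ(u, v)`, computed in the preferred chart at `x`, where
`dα(u, v) = (Dα u) v - (Dα v) u` for a one-form `α` on an open subset of `ℝᵐ`. -/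
def VectorOneForm.extD (η : VectorOneForm m k M) (x : M) :
    TangentSpace (𝓡 m) x →L[ℝ] TangentSpace (𝓡 m) x →L[ℝ] EuclideanSpace ℝ (Fin k) :=
  let φ := chartAt (EuclideanSpace ℝ (Fin m)) x
  let A : EuclideanSpace ℝ (Fin m) →L[ℝ] EuclideanSpace ℝ (Fin m) →L[ℝ] EuclideanSpace ℝ (Fin k) :=
    fderiv ℝ (η.inChart x) (φ x)
  let dφ : EuclideanSpace ℝ (Fin m) →L[ℝ] EuclideanSpace ℝ (Fin m) := mfderiv (𝓡 m) (𝓡 m) φ x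
  let dη : EuclideanSpace ℝ (Fin m) →L[ℝ] EuclideanSpace ℝ (Fin m) →L[ℝ] EuclideanSpace ℝ (Fin k) :=
    (A - A.flip).bilinearComp dφ dφ
  dη

/-- The distribution `ker η`. -/
def VectorOneForm.ker (η : VectorOneForm m k M) : TangentDistribution m M :=
  fun x => LinearMap.ker (η x : TangentSpace (𝓡 m) x →ₗ[ℝ] EuclideanSpace ℝ (Fin k))

/-- The distribution `ker dη`, of all `v` such that `dη(v, ·) = 0`. -/
def VectorOneForm.kerExtD (η : VectorOneForm m k M) : TangentDistribution m M :=
  fun x => LinearMap.ker (η.extD x : TangentSpace (𝓡 m) x →ₗ[ℝ]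
    TangentSpace (𝓡 m) x →L[ℝ] EuclideanSpace ℝ (Fin k))

/-- `η` is a `k`-contact form on the open set `U`: `ker η` is a regular non-zero distribution of
corank `k`, `ker dη` is a regular distribution of rank `k`, and `ker η ∩ ker dη = 0`. -/
structure IsKContactFormOn [IsManifold (𝓡 m) ∞ M] (η : VectorOneForm m k M) (U : Set M) :
    Prop where
  smooth : η.IsSmoothOn U
  ker_regular : ∃ r : ℕ, 0 < r ∧ r + k = m ∧ IsRegularOn η.ker U r
  kerExtD_regular : IsRegularOn η.kerExtD U k
  inf_eq_bot : ∀ x ∈ U, η.ker x ⊓ η.kerExtD x = ⊥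

/-- `D` is a `k`-contact distribution: locally it is the kernel of a `k`-contact form. -/
def IsKContactDistribution [IsManifold (𝓡 m) ∞ M] (k : ℕ) (D : TangentDistribution m M) : Prop :=
  ∀ x : M, ∃ U : Set M, IsOpen U ∧ x ∈ U ∧ ∃ η : VectorOneForm m k M,
    IsKContactFormOn η U ∧ ∀ y ∈ U, D y = η.ker y

/-- `(M, D, V)` is a polarised `k`-contact manifold, with `dim M = (n + 1)(k + 1) - 1`: the
distribution `D` is `k`-contact and `V` is an integrable subbundle of `D` of rank `n k`. -/
structure IsPolarisedKContact [IsManifold (𝓡 m) ∞ M] (n k : ℕ) (D V : TangentDistribution m M) :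
    Prop where
  dim_eq : m + 1 = (n + 1) * (k + 1)
  kContact : IsKContactDistribution k D
  le : ∀ x, V x ≤ D x
  regular : IsRegularOn V univ (n * k)
  integrable : IsIntegrable V

end Distributions

/-! ### Fibre bundles and first-order jets

`N` is a manifold modelled on `A` (the base), `F` a manifold modelled on `B` (the typical fibre)
and `Y` a manifold modelled on `A × B` (the total space). -/

section Jets

variable {A B : Type*} [NormedAddCommGroup A] [NormedSpace ℝ A]
  [NormedAddCommGroup B] [NormedSpace ℝ B]

/-- A smooth fibre bundle `Y → N` with typical fibre `F`: a smooth surjection which is locally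
trivial through diffeomorphisms onto products `U × F`. -/
structure SmoothFibreBundle (A B : Type*) [NormedAddCommGroup A] [NormedSpace ℝ A]
    [NormedAddCommGroup B] [NormedSpace ℝ B]
    (N F Y : Type*) [TopologicalSpace N] [ChartedSpace A N]
    [TopologicalSpace F] [ChartedSpace B F] [TopologicalSpace Y] [ChartedSpace (A × B) Y] where
  proj : Y → N
  contMDiff_proj : ContMDiff 𝓘(ℝ, A × B) 𝓘(ℝ, A) ∞ proj
  surjective_proj : Function.Surjective proj
  exists_trivialization : ∀ x : N, ∃ t : Trivialization F proj, x ∈ t.baseSet ∧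
    ContMDiffOn 𝓘(ℝ, A × B) (𝓘(ℝ, A).prod 𝓘(ℝ, B)) ∞ t.toOpenPartialHomeomorph t.source ∧
    ContMDiffOn (𝓘(ℝ, A).prod 𝓘(ℝ, B)) 𝓘(ℝ, A × B) ∞ t.toOpenPartialHomeomorph.symm t.target

variable {N F Y : Type*} [TopologicalSpace N] [ChartedSpace A N]
  [TopologicalSpace F] [ChartedSpace B F] [TopologicalSpace Y] [ChartedSpace (A × B) Y]

/-- The first-order jet manifold `J¹(N, Y)`: a first-order jet of sections at `p ∈ N` is a point
`y` of the fibre over `p` with a linear right inverse `L : T_p N → T_y Y` of the differential of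
the projection (the value at `p` and the differential at `p` of a local section). -/
structure Jet1 (b : SmoothFibreBundle A B N F Y) where
  pt : Y
  lin : TangentSpace 𝓘(ℝ, A) (b.proj pt) →L[ℝ] TangentSpace 𝓘(ℝ, A × B) pt
  mfderiv_lin : ∀ v, mfderiv 𝓘(ℝ, A × B) 𝓘(ℝ, A) b.proj pt (lin v) = v

/-- Adapted coordinates of a fibre bundle: smooth coordinates `x = base` on an open set of the
base and smooth coordinates `(x, y) = total` on an open set of the total space. -/
structure AdaptedChart (b : SmoothFibreBundle A B N F Y) where
  base : OpenPartialHomeomorph N A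
  total : OpenPartialHomeomorph Y (A × B)
  base_smooth : ContMDiffOn 𝓘(ℝ, A) 𝓘(ℝ, A) ∞ base base.source
  base_symm_smooth : ContMDiffOn 𝓘(ℝ, A) 𝓘(ℝ, A) ∞ base.symm base.target
  total_smooth : ContMDiffOn 𝓘(ℝ, A × B) 𝓘(ℝ, A × B) ∞ total total.source
  total_symm_smooth : ContMDiffOn 𝓘(ℝ, A × B) 𝓘(ℝ, A × B) ∞ total.symm total.target
  proj_mem : ∀ e ∈ total.source, b.proj e ∈ base.source
  total_fst : ∀ e ∈ total.source, (total e).1 = base (b.proj e)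

variable {b : SmoothFibreBundle A B N F Y}

theorem Jet1.ext' {j j' : Jet1 b} (h : j.pt = j'.pt)
    (h' : ∀ v : A, (j.lin v : A × B) = (j'.lin v : A × B)) : j = j' := by
  obtain ⟨e, L, hL⟩ := j
  obtain ⟨e', L', hL'⟩ := j'
  dsimp only at h
  subst h
  have : L = L' := ContinuousLinearMap.ext h'
  subst this
  rfl

namespace AdaptedChart

variable (c : AdaptedChart b)

/-- Differential of the coordinates `x` at the projection of `e`. -/
def dBase (e : Y) : A →L[ℝ] A := mfderiv 𝓘(ℝ, A) 𝓘(ℝ, A) c.base (b.proj e)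

/-- Differential of the inverse of the coordinates `x` at the coordinates of the projection of
`e`. -/
def dBaseSymm (e : Y) : A →L[ℝ] A := mfderiv 𝓘(ℝ, A) 𝓘(ℝ, A) c.base.symm (c.base (b.proj e))

/-- Differential of the coordinates `(x, y)` at `e`. -/
def dTotal (e : Y) : A × B →L[ℝ] A × B := mfderiv 𝓘(ℝ, A × B) 𝓘(ℝ, A × B) c.total e

/-- Differential of the inverse of the coordinates `(x, y)` at the coordinates of `e`. -/
def dTotalSymm (e : Y) : A × B →L[ℝ] A × B :=
  mfderiv 𝓘(ℝ, A × B) 𝓘(ℝ, A × B) c.total.symm (c.total e)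

end AdaptedChart

/-- Differential of the bundle projection at `e`. -/
def SmoothFibreBundle.dProj (b : SmoothFibreBundle A B N F Y) (e : Y) : A × B →L[ℝ] A :=
  mfderiv 𝓘(ℝ, A × B) 𝓘(ℝ, A) b.proj e

namespace AdaptedChart

variable (c : AdaptedChart b)

theorem mdiff_base {p : N} (hp : p ∈ c.base.source) :
    MDifferentiableAt 𝓘(ℝ, A) 𝓘(ℝ, A) c.base p :=
  (c.base_smooth.contMDiffAt (c.base.open_source.mem_nhds hp)).mdifferentiableAt (by simp)

theorem mdiff_base_symm {p : A} (hp : p ∈ c.base.target) :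
    MDifferentiableAt 𝓘(ℝ, A) 𝓘(ℝ, A) c.base.symm p :=
  (c.base_symm_smooth.contMDiffAt (c.base.open_target.mem_nhds hp)).mdifferentiableAt (by simp)

theorem mdiff_total {e : Y} (he : e ∈ c.total.source) :
    MDifferentiableAt 𝓘(ℝ, A × B) 𝓘(ℝ, A × B) c.total e :=
  (c.total_smooth.contMDiffAt (c.total.open_source.mem_nhds he)).mdifferentiableAt (by simp)

theorem mdiff_total_symm {z : A × B} (hz : z ∈ c.total.target) :
    MDifferentiableAt 𝓘(ℝ, A × B) 𝓘(ℝ, A × B) c.total.symm z :=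
  (c.total_symm_smooth.contMDiffAt (c.total.open_target.mem_nhds hz)).mdifferentiableAt (by simp)

theorem mdiff_proj (b : SmoothFibreBundle A B N F Y) (e : Y) :
    MDifferentiableAt 𝓘(ℝ, A × B) 𝓘(ℝ, A) b.proj e :=
  b.contMDiff_proj.contMDiffAt.mdifferentiableAt (by simp)

theorem dBase_dBaseSymm {e : Y} (he : e ∈ c.total.source) (v : A) :
    c.dBase e (c.dBaseSymm e v) = v := by
  have hp := c.proj_mem e he
  have hq := c.base.map_source hp
  have h1 : MDifferentiableAt 𝓘(ℝ, A) 𝓘(ℝ, A) c.base (c.base.symm (c.base (b.proj e))) := by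
    rw [c.base.left_inv hp]; exact c.mdiff_base hp
  have h := mfderiv_comp (c.base (b.proj e)) h1 (c.mdiff_base_symm hq)
  have h2 : c.base ∘ c.base.symm =ᶠ[𝓝 (c.base (b.proj e))] id :=
    Filter.eventuallyEq_of_mem (c.base.open_target.mem_nhds hq) fun z hz => c.base.right_inv hz
  rw [h2.mfderiv_eq, mfderiv_id] at h
  have h3 : v = (mfderiv 𝓘(ℝ, A) 𝓘(ℝ, A) c.base (c.base.symm (c.base (b.proj e))) : A →L[ℝ] A)
      (c.dBaseSymm e v) := congrArg (fun T : A →L[ℝ] A => T v) h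
  have h4 : (mfderiv 𝓘(ℝ, A) 𝓘(ℝ, A) c.base (c.base.symm (c.base (b.proj e))) : A →L[ℝ] A) =
      c.dBase e := by
    rw [c.base.left_inv hp]; rfl
  rw [h4] at h3
  exact h3.symm

theorem dBaseSymm_dBase {e : Y} (he : e ∈ c.total.source) (v : A) :
    c.dBaseSymm e (c.dBase e v) = v := by
  have hp := c.proj_mem e he
  have hq := c.base.map_source hp
  have h := mfderiv_comp (b.proj e) (c.mdiff_base_symm hq) (c.mdiff_base hp)
  have h2 : c.base.symm ∘ c.base =ᶠ[𝓝 (b.proj e)] id :=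
    Filter.eventuallyEq_of_mem (c.base.open_source.mem_nhds hp) fun z hz => c.base.left_inv hz
  rw [h2.mfderiv_eq, mfderiv_id] at h
  exact (congrArg (fun T : A →L[ℝ] A => T v) h).symm

theorem dTotal_dTotalSymm {e : Y} (he : e ∈ c.total.source) (v : A × B) :
    c.dTotal e (c.dTotalSymm e v) = v := by
  have hq := c.total.map_source he
  have h1 : MDifferentiableAt 𝓘(ℝ, A × B) 𝓘(ℝ, A × B) c.total (c.total.symm (c.total e)) := by
    rw [c.total.left_inv he]; exact c.mdiff_total he
  have h := mfderiv_comp (c.total e) h1 (c.mdiff_total_symm hq)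
  have h2 : c.total ∘ c.total.symm =ᶠ[𝓝 (c.total e)] id :=
    Filter.eventuallyEq_of_mem (c.total.open_target.mem_nhds hq) fun z hz => c.total.right_inv hz
  rw [h2.mfderiv_eq, mfderiv_id] at h
  have h3 : v = (mfderiv 𝓘(ℝ, A × B) 𝓘(ℝ, A × B) c.total (c.total.symm (c.total e)) :
      A × B →L[ℝ] A × B) (c.dTotalSymm e v) := congrArg (fun T : A × B →L[ℝ] A × B => T v) h
  have h4 : (mfderiv 𝓘(ℝ, A × B) 𝓘(ℝ, A × B) c.total (c.total.symm (c.total e)) :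
      A × B →L[ℝ] A × B) = c.dTotal e := by
    rw [c.total.left_inv he]; rfl
  rw [h4] at h3
  exact h3.symm

theorem dTotalSymm_dTotal {e : Y} (he : e ∈ c.total.source) (v : A × B) :
    c.dTotalSymm e (c.dTotal e v) = v := by
  have hq := c.total.map_source he
  have h := mfderiv_comp e (c.mdiff_total_symm hq) (c.mdiff_total he)
  have h2 : c.total.symm ∘ c.total =ᶠ[𝓝 e] id :=
    Filter.eventuallyEq_of_mem (c.total.open_source.mem_nhds he) fun z hz => c.total.left_inv hz
  rw [h2.mfderiv_eq, mfderiv_id] at h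
  exact (congrArg (fun T : A × B →L[ℝ] A × B => T v) h).symm

theorem dTotal_fst {e : Y} (he : e ∈ c.total.source) (v : A × B) :
    (c.dTotal e v).1 = c.dBase e (b.dProj e v) := by
  have h := mfderiv_comp e (c.mdiff_base (c.proj_mem e he)) (mdiff_proj b e)
  have h2 : c.base ∘ b.proj =ᶠ[𝓝 e] Prod.fst ∘ c.total :=
    Filter.eventuallyEq_of_mem (c.total.open_source.mem_nhds he)
      fun z hz => (c.total_fst z hz).symm
  have hfst : MDifferentiableAt 𝓘(ℝ, A × B) 𝓘(ℝ, A) (Prod.fst : A × B → A) (c.total e) :=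
    differentiableAt_fst.mdifferentiableAt
  have h3 := mfderiv_comp e hfst (c.mdiff_total he)
  rw [mfderiv_eq_fderiv, fderiv_fst] at h3
  rw [h2.mfderiv_eq, h3] at h
  exact congrArg (fun T : A × B →L[ℝ] A => T v) h

/-- The coordinates `(x, y, p)` of a jet induced by adapted coordinates `(x, y)`: the matrix `p`
is the `y`-component of the derivative of a section with respect to `x`. -/
def jetCoord (j : Jet1 b) : (A × B) × (A →L[ℝ] B) :=
  (c.total j.pt, (ContinuousLinearMap.snd ℝ A B).comp
    ((c.dTotal j.pt).comp (ContinuousLinearMap.comp (j.lin : A →L[ℝ] A × B) (c.dBaseSymm j.pt))))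

/-- The jet over `e` in the domain of adapted coordinates with derivative coordinates `p`. -/
def jetOfCoord (e : Y) (he : e ∈ c.total.source) (p : A →L[ℝ] B) : Jet1 b where
  pt := e
  lin := (c.dTotalSymm e).comp (((ContinuousLinearMap.id ℝ A).prod p).comp (c.dBase e))
  mfderiv_lin := by
    intro v
    change b.dProj e (c.dTotalSymm e ((ContinuousLinearMap.id ℝ A).prod p (c.dBase e v))) = v
    have h := c.dTotal_fst he
      (c.dTotalSymm e ((ContinuousLinearMap.id ℝ A).prod p (c.dBase e v)))
    rw [c.dTotal_dTotalSymm he] at h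
    have h2 := congrArg (c.dBaseSymm e) h
    rw [c.dBaseSymm_dBase he] at h2
    rw [← h2]
    exact c.dBaseSymm_dBase he v

theorem jetCoord_jetOfCoord (e : Y) (he : e ∈ c.total.source) (p : A →L[ℝ] B) :
    c.jetCoord (c.jetOfCoord e he p) = (c.total e, p) := by
  refine Prod.ext rfl (ContinuousLinearMap.ext fun v => ?_)
  change (c.dTotal e (c.dTotalSymm e ((ContinuousLinearMap.id ℝ A).prod p
    (c.dBase e (c.dBaseSymm e v))))).2 = p v
  rw [c.dTotal_dTotalSymm he, c.dBase_dBaseSymm he]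
  rfl

theorem jetOfCoord_jetCoord (j : Jet1 b) (hj : j.pt ∈ c.total.source) (e : Y)
    (he : e ∈ c.total.source) (h : e = j.pt) : c.jetOfCoord e he (c.jetCoord j).2 = j := by
  subst h
  refine Jet1.ext' rfl fun v => ?_
  change c.dTotalSymm j.pt (c.dBase j.pt v, (c.dTotal j.pt
    ((j.lin : A →L[ℝ] A × B) (c.dBaseSymm j.pt (c.dBase j.pt v)))).2) =
      (j.lin : A →L[ℝ] A × B) v
  rw [c.dBaseSymm_dBase hj]
  have h1 : c.dBase j.pt v = (c.dTotal j.pt ((j.lin : A →L[ℝ] A × B) v)).1 :=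
    (congrArg (c.dBase j.pt) (j.mfderiv_lin v).symm).trans (c.dTotal_fst hj _).symm
  rw [h1]
  exact c.dTotalSymm_dTotal hj _

open Classical in
/-- The chart of `J¹(N, Y)` induced by adapted coordinates. -/
def jetChart [Nonempty (Jet1 b)] : PartialEquiv (Jet1 b) ((A × B) × (A →L[ℝ] B)) where
  toFun := c.jetCoord
  invFun := fun z => if h : z.1 ∈ c.total.target then
    c.jetOfCoord (c.total.symm z.1) (c.total.map_target h) z.2 else Classical.arbitrary _
  source := {j | j.pt ∈ c.total.source}
  target := c.total.target ×ˢ univ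
  map_source' := fun j hj => ⟨c.total.map_source hj, mem_univ _⟩
  map_target' := by
    rintro z ⟨hz, -⟩
    simp only [hz, dif_pos, mem_ofPred_eq]
    exact c.total.map_target hz
  left_inv' := by
    intro j hj
    have h : (c.jetCoord j).1 ∈ c.total.target := c.total.map_source hj
    rw [dif_pos h]
    exact c.jetOfCoord_jetCoord j hj _ _ (c.total.left_inv hj)
  right_inv' := by
    rintro z ⟨hz, -⟩
    simp only [hz, dif_pos]
    rw [c.jetCoord_jetOfCoord, c.total.right_inv hz]

/-- The change of adapted coordinates on the total space. -/
def transTotal (c c' : AdaptedChart b) : A × B → A × B := c'.total ∘ c.total.symm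

/-- The change of adapted coordinates on the base. -/
def transBase (c c' : AdaptedChart b) : A → A := c'.base ∘ c.base.symm

/-- The domain of the change of adapted coordinates on the total space. -/
def transSource (c c' : AdaptedChart b) : Set (A × B) :=
  c.total.target ∩ c.total.symm ⁻¹' c'.total.source

theorem isOpen_transSource (c c' : AdaptedChart b) : IsOpen (transSource c c') :=
  c.total.isOpen_inter_preimage_symm c'.total.open_source

theorem contDiffOn_transTotal (c c' : AdaptedChart b) :
    ContDiffOn ℝ ∞ (transTotal c c') (transSource c c') := by
  rw [← contMDiffOn_iff_contDiffOn]
  exact c'.total_smooth.comp (c.total_symm_smooth.mono inter_subset_left) inter_subset_right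

theorem isOpen_transBaseSource (c c' : AdaptedChart b) :
    IsOpen (c.base.target ∩ c.base.symm ⁻¹' c'.base.source) :=
  c.base.isOpen_inter_preimage_symm c'.base.open_source

theorem contDiffOn_transBase (c c' : AdaptedChart b) :
    ContDiffOn ℝ ∞ (transBase c c') (c.base.target ∩ c.base.symm ⁻¹' c'.base.source) := by
  rw [← contMDiffOn_iff_contDiffOn]
  exact c'.base_smooth.comp (c.base_symm_smooth.mono inter_subset_left) inter_subset_right

theorem transTotal_fst_mem (c c' : AdaptedChart b) {z : A × B} (hz : z ∈ transSource c c') :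
    (transTotal c c' z).1 ∈ c'.base.target ∩ c'.base.symm ⁻¹' c.base.source := by
  have he : c.total.symm z ∈ c.total.source := c.total.map_target hz.1
  have h : (transTotal c c' z).1 = c'.base (b.proj (c.total.symm z)) := c'.total_fst _ hz.2
  have hp := c'.proj_mem _ hz.2
  rw [h]
  refine ⟨c'.base.map_source hp, ?_⟩
  rw [mem_preimage, c'.base.left_inv hp]
  exact c.proj_mem _ he

/-- The change of adapted coordinates on the jet manifold. -/
def jetTrans (c c' : AdaptedChart b) (z : (A × B) × (A →L[ℝ] B)) : (A × B) × (A →L[ℝ] B) :=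
  (transTotal c c' z.1, (ContinuousLinearMap.snd ℝ A B).comp
    ((fderiv ℝ (transTotal c c') z.1).comp (((ContinuousLinearMap.id ℝ A).prod z.2).comp
      (fderiv ℝ (transBase c' c) (transTotal c c' z.1).1))))

theorem contDiffOn_jetTrans (c c' : AdaptedChart b) :
    ContDiffOn ℝ ∞ (jetTrans c c') (transSource c c' ×ˢ univ) := by
  have h1 : ContDiffOn ℝ ∞ (fun z : (A × B) × (A →L[ℝ] B) => transTotal c c' z.1)
      (transSource c c' ×ˢ univ) :=
    (contDiffOn_transTotal c c').comp contDiff_fst.contDiffOn fun z hz => hz.1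
  have h2 : ContDiffOn ℝ ∞ (fun z : (A × B) × (A →L[ℝ] B) => fderiv ℝ (transTotal c c') z.1)
      (transSource c c' ×ˢ univ) :=
    ((contDiffOn_transTotal c c').fderiv_of_isOpen (isOpen_transSource c c') (by simp)).comp
      contDiff_fst.contDiffOn fun z hz => hz.1
  have h3 : ContDiffOn ℝ ∞ (fun z : (A × B) × (A →L[ℝ] B) =>
      fderiv ℝ (transBase c' c) (transTotal c c' z.1).1) (transSource c c' ×ˢ univ) :=
    ((contDiffOn_transBase c' c).fderiv_of_isOpen (isOpen_transBaseSource c' c) (by simp)).comp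
      (contDiff_fst.comp_contDiffOn h1) fun z hz => transTotal_fst_mem c c' hz.1
  have h4 : ContDiff ℝ ∞ (fun z : (A × B) × (A →L[ℝ] B) =>
      (ContinuousLinearMap.id ℝ A).prod z.2) := by
    have h : (fun z : (A × B) × (A →L[ℝ] B) => (ContinuousLinearMap.id ℝ A).prod z.2) =
        fun z => ContinuousLinearMap.inl ℝ A B + (ContinuousLinearMap.inr ℝ A B).comp z.2 := by
      funext z
      ext v <;> simp
    rw [h]
    exact contDiff_const.add (contDiff_const.clm_comp contDiff_snd)
  exact h1.prodMk (contDiffOn_const.clm_comp (h2.clm_comp (h4.contDiffOn.clm_comp h3)))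

theorem fderiv_transTotal (c c' : AdaptedChart b) {e : Y} (he : e ∈ c.total.source)
    (he' : e ∈ c'.total.source) (v : A × B) :
    fderiv ℝ (transTotal c c') (c.total e) v = c'.dTotal e (c.dTotalSymm e v) := by
  have h1 : MDifferentiableAt 𝓘(ℝ, A × B) 𝓘(ℝ, A × B) c'.total (c.total.symm (c.total e)) := by
    rw [c.total.left_inv he]; exact c'.mdiff_total he'
  have h := mfderiv_comp (c.total e) h1 (c.mdiff_total_symm (c.total.map_source he))
  have h4 : (mfderiv 𝓘(ℝ, A × B) 𝓘(ℝ, A × B) c'.total (c.total.symm (c.total e)) :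
      A × B →L[ℝ] A × B) = c'.dTotal e := by
    rw [c.total.left_inv he]; rfl
  rw [mfderiv_eq_fderiv] at h
  have h3 : fderiv ℝ (transTotal c c') (c.total e) v =
      (mfderiv 𝓘(ℝ, A × B) 𝓘(ℝ, A × B) c'.total (c.total.symm (c.total e)) :
        A × B →L[ℝ] A × B) (c.dTotalSymm e v) := congrArg (fun T : A × B →L[ℝ] A × B => T v) h
  exact h3.trans (congrArg (fun T : A × B →L[ℝ] A × B => T (c.dTotalSymm e v)) h4)

theorem fderiv_transBase (c c' : AdaptedChart b) {e : Y} (he : e ∈ c.total.source)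
    (he' : e ∈ c'.total.source) (v : A) :
    fderiv ℝ (transBase c c') (c.base (b.proj e)) v = c'.dBase e (c.dBaseSymm e v) := by
  have hp := c.proj_mem e he
  have h1 : MDifferentiableAt 𝓘(ℝ, A) 𝓘(ℝ, A) c'.base (c.base.symm (c.base (b.proj e))) := by
    rw [c.base.left_inv hp]; exact c'.mdiff_base (c'.proj_mem e he')
  have h := mfderiv_comp (c.base (b.proj e)) h1 (c.mdiff_base_symm (c.base.map_source hp))
  have h4 : (mfderiv 𝓘(ℝ, A) 𝓘(ℝ, A) c'.base (c.base.symm (c.base (b.proj e))) :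
      A →L[ℝ] A) = c'.dBase e := by
    rw [c.base.left_inv hp]; rfl
  rw [mfderiv_eq_fderiv] at h
  have h3 : fderiv ℝ (transBase c c') (c.base (b.proj e)) v =
      (mfderiv 𝓘(ℝ, A) 𝓘(ℝ, A) c'.base (c.base.symm (c.base (b.proj e))) :
        A →L[ℝ] A) (c.dBaseSymm e v) := congrArg (fun T : A →L[ℝ] A => T v) h
  exact h3.trans (congrArg (fun T : A →L[ℝ] A => T (c.dBaseSymm e v)) h4)

theorem jetCoord_jetOfCoord_trans (c c' : AdaptedChart b) {e : Y} (he : e ∈ c.total.source)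
    (he' : e ∈ c'.total.source) (p : A →L[ℝ] B) :
    c'.jetCoord (c.jetOfCoord e he p) = jetTrans c c' (c.total e, p) := by
  have h0 : transTotal c c' (c.total e) = c'.total e := congrArg c'.total (c.total.left_inv he)
  refine Prod.ext h0.symm (ContinuousLinearMap.ext fun v => ?_)
  change (c'.dTotal e (c.dTotalSymm e ((ContinuousLinearMap.id ℝ A).prod p
    (c.dBase e (c'.dBaseSymm e v))))).2 =
    (fderiv ℝ (transTotal c c') (c.total e) ((ContinuousLinearMap.id ℝ A).prod p
      (fderiv ℝ (transBase c' c) (transTotal c c' (c.total e)).1 v))).2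
  rw [h0, c'.total_fst e he', fderiv_transBase c' c he' he, fderiv_transTotal c c' he he']

variable [Nonempty (Jet1 b)]

theorem jetChart_trans_source (c c' : AdaptedChart b) :
    (c.jetChart.symm.trans c'.jetChart).source = transSource c c' ×ˢ univ := by
  ext z
  by_cases hz : z.1 ∈ c.total.target
  · have h : c.jetChart.symm z = c.jetOfCoord (c.total.symm z.1) (c.total.map_target hz) z.2 :=
      dif_pos hz
    constructor
    · rintro ⟨-, h2⟩
      rw [mem_preimage, PartialEquiv.symm_symm, h] at h2
      exact ⟨⟨hz, h2⟩, mem_univ _⟩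
    · rintro ⟨⟨-, h2⟩, -⟩
      refine ⟨⟨hz, mem_univ _⟩, ?_⟩
      rw [mem_preimage, PartialEquiv.symm_symm, h]
      exact h2
  · exact ⟨fun h => absurd h.1.1 hz, fun h => absurd h.1.1 hz⟩

theorem jetChart_trans_eqOn (c c' : AdaptedChart b) :
    EqOn (c.jetChart.symm.trans c'.jetChart) (jetTrans c c') (transSource c c' ×ˢ univ) := by
  rintro z ⟨hz, -⟩
  have h : c.jetChart.symm z = c.jetOfCoord (c.total.symm z.1) (c.total.map_target hz.1) z.2 :=
    dif_pos hz.1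
  change c'.jetCoord (c.jetChart.symm z) = _
  rw [h, jetCoord_jetOfCoord_trans c c' _ hz.2, c.total.right_inv hz.1]

end AdaptedChart

section Instances

variable [IsManifold 𝓘(ℝ, A) ∞ N] [IsManifold 𝓘(ℝ, B) ∞ F]

theorem AdaptedChart.exists_mem_source (b : SmoothFibreBundle A B N F Y) (e : Y) :
    ∃ c : AdaptedChart b, e ∈ c.total.source := by
  obtain ⟨t, hx, ht, ht'⟩ := b.exists_trivialization (b.proj e)
  have he : e ∈ t.source := by rw [t.source_eq]; exact hx
  let φ := chartAt A (b.proj e)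
  let χ := chartAt B (t.toOpenPartialHomeomorph e).2
  let Φ : OpenPartialHomeomorph (N × F) (A × B) := φ.prod χ
  have hφ : ContMDiffOn 𝓘(ℝ, A) 𝓘(ℝ, A) ∞ φ φ.source := contMDiffOn_chart
  have hχ : ContMDiffOn 𝓘(ℝ, B) 𝓘(ℝ, B) ∞ χ χ.source := contMDiffOn_chart
  have hφ' : ContMDiffOn 𝓘(ℝ, A) 𝓘(ℝ, A) ∞ φ.symm φ.target := contMDiffOn_chart_symm
  have hχ' : ContMDiffOn 𝓘(ℝ, B) 𝓘(ℝ, B) ∞ χ.symm χ.target := contMDiffOn_chart_symm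
  have hΦ : ContMDiffOn (𝓘(ℝ, A).prod 𝓘(ℝ, B)) 𝓘(ℝ, A × B) ∞ Φ Φ.source :=
    (hφ.comp contMDiffOn_fst fun z hz => hz.1).prodMk_space
      (hχ.comp contMDiffOn_snd fun z hz => hz.2)
  have hΦ' : ContMDiffOn 𝓘(ℝ, A × B) (𝓘(ℝ, A).prod 𝓘(ℝ, B)) ∞ Φ.symm Φ.target := by
    have h1 : ContMDiffOn 𝓘(ℝ, A × B) 𝓘(ℝ, A) ∞ (Prod.fst : A × B → A) Φ.target :=
      contDiff_fst.contMDiff.contMDiffOn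
    have h2 : ContMDiffOn 𝓘(ℝ, A × B) 𝓘(ℝ, B) ∞ (Prod.snd : A × B → B) Φ.target :=
      contDiff_snd.contMDiff.contMDiffOn
    exact (hφ'.comp h1 fun z hz => hz.1).prodMk (hχ'.comp h2 fun z hz => hz.2)
  have hfst : ∀ z ∈ t.source, (t.toOpenPartialHomeomorph z).1 = b.proj z := t.proj_toFun
  refine ⟨{ base := φ, total := t.toOpenPartialHomeomorph.trans Φ
            base_smooth := hφ, base_symm_smooth := hφ'
            total_smooth := ?_, total_symm_smooth := ?_
            proj_mem := ?_, total_fst := ?_ }, ?_⟩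
  · exact hΦ.comp (ht.mono fun z hz => hz.1) fun z hz => hz.2
  · exact ht'.comp (hΦ'.mono fun z hz => hz.1) fun z hz => hz.2
  · rintro z ⟨hz, hz'⟩
    rw [← hfst z hz]
    exact hz'.1
  · rintro z ⟨hz, -⟩
    change φ (t.toOpenPartialHomeomorph z).1 = _
    rw [hfst z hz]
  · refine ⟨he, ?_, mem_chart_source B _⟩
    change (t.toOpenPartialHomeomorph e).1 ∈ φ.source
    rw [hfst e he]
    exact mem_chart_source A _

namespace Jet1

/-- The atlas of `J¹(N, Y)` formed by the charts induced by all adapted coordinates. -/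
def chartedSpaceCore (b : SmoothFibreBundle A B N F Y) :
    ChartedSpaceCore ((A × B) × (A →L[ℝ] B)) (Jet1 b) where
  atlas := {f | ∃ (c : AdaptedChart b) (_ : Nonempty (Jet1 b)), f = c.jetChart}
  chartAt := fun j =>
    haveI : Nonempty (Jet1 b) := ⟨j⟩
    (AdaptedChart.exists_mem_source b j.pt).choose.jetChart
  mem_chart_source := fun j => (AdaptedChart.exists_mem_source b j.pt).choose_spec
  chart_mem_atlas := fun j => ⟨_, ⟨j⟩, rfl⟩
  open_source := by
    rintro _ _ ⟨c, h, rfl⟩ ⟨c', h', rfl⟩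
    rw [AdaptedChart.jetChart_trans_source]
    exact (AdaptedChart.isOpen_transSource c c').prod isOpen_univ
  continuousOn_toFun := by
    rintro _ _ ⟨c, h, rfl⟩ ⟨c', h', rfl⟩
    rw [AdaptedChart.jetChart_trans_source]
    exact (AdaptedChart.contDiffOn_jetTrans c c').continuousOn.congr
      (AdaptedChart.jetChart_trans_eqOn c c')

instance : TopologicalSpace (Jet1 b) := (chartedSpaceCore b).toTopologicalSpace

instance : ChartedSpace ((A × B) × (A →L[ℝ] B)) (Jet1 b) := (chartedSpaceCore b).toChartedSpace

instance : IsManifold 𝓘(ℝ, (A × B) × (A →L[ℝ] B)) ∞ (Jet1 b) := by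
  refine isManifold_of_contDiffOn _ _ _ fun e e' he he' => ?_
  obtain ⟨f, hf⟩ := mem_iUnion.1 he
  obtain ⟨⟨c, h, rfl⟩, rfl⟩ := mem_iUnion.1 hf
  obtain ⟨f', hf'⟩ := mem_iUnion.1 he'
  obtain ⟨⟨c', h', rfl⟩, rfl⟩ := mem_iUnion.1 hf'
  simp only [modelWithCornersSelf_coe, modelWithCornersSelf_coe_symm, range_id, inter_univ,
    preimage_id, Function.comp_id, Function.id_comp]
  have hs := AdaptedChart.jetChart_trans_source c c'
  refine ContDiffOn.congr (f := AdaptedChart.jetTrans c c') ?_ ?_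
  · exact (AdaptedChart.contDiffOn_jetTrans c c').mono hs.le
  · exact fun z hz => AdaptedChart.jetChart_trans_eqOn c c' (hs.le hz)

/-- The Cartan distribution of `J¹(N, Y)`: at a jet `(y, L)` it consists of the tangent vectors
whose projection to `T_y Y` lies in the image of `L`, the tangent space at `y` of the sections
with this jet. -/
def cartan (j : Jet1 b) :
    Submodule ℝ (TangentSpace 𝓘(ℝ, (A × B) × (A →L[ℝ] B)) j) :=
  Submodule.comap
    (mfderiv 𝓘(ℝ, (A × B) × (A →L[ℝ] B)) 𝓘(ℝ, A × B) (Jet1.pt : Jet1 b → Y) j :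
      TangentSpace 𝓘(ℝ, (A × B) × (A →L[ℝ] B)) j →ₗ[ℝ] TangentSpace 𝓘(ℝ, A × B) j.pt)
    (LinearMap.range (j.lin : TangentSpace 𝓘(ℝ, A) (b.proj j.pt) →ₗ[ℝ]
      TangentSpace 𝓘(ℝ, A × B) j.pt))

/-- The vertical distribution of the projection `J¹(N, Y) → Y`. -/
def vertical (j : Jet1 b) :
    Submodule ℝ (TangentSpace 𝓘(ℝ, (A × B) × (A →L[ℝ] B)) j) :=
  LinearMap.ker
    (mfderiv 𝓘(ℝ, (A × B) × (A →L[ℝ] B)) 𝓘(ℝ, A × B) (Jet1.pt : Jet1 b → Y) j :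
      TangentSpace 𝓘(ℝ, (A × B) × (A →L[ℝ] B)) j →ₗ[ℝ] TangentSpace 𝓘(ℝ, A × B) j.pt)

end Jet1

end Instances

end Jets
end

/-!
The bundle is the trivial one, `ℝⁿ × ℝᵏ → ℝⁿ`; its jet manifold has global coordinates `(x, y, p)`
with `p : ℝⁿ → ℝᵏ` linear, in which the Cartan distribution is `dy = p dx` and the vertical
distribution is `dx = dy = 0`. It remains to find such coordinates near every point of `M`.

The leaf space of the foliation tangent to `V` is locally `ℝⁿ × ℝᵏ`. As `V ⊆ D`, the distribution
`D` at a point is the preimage of an `n`-plane in the tangent space of the leaf space, and for a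
suitable linear splitting of the leaf space this plane is the graph of a linear map
`G : ℝⁿ → ℝᵏ` near the given point. The coordinates are `(x, y)`, the leaf, and `p = G`.
In these, `D` and `V` have the required form by construction, so only the fact that they are
coordinates needs the contact condition: it says that `dη` is nondegenerate on `D`
(`IsKContactFormOn.nondegenerate`), and since `η` vanishes on `V`, the derivative of `G` along a leaf
is `dη` paired with `D / V`, up to a linear isomorphism. So the derivative of `(x, y, G)` is
injective, and the inverse function theorem applies since both dimensions are `n + k + nk`.
This is `exists_jet_coordinates`, carried out in a chart of `M`;
`IsPolarisedKContact.exists_coordinates` transfers it to the manifold.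

It is enough to know nondegeneracy at the given point. The whole computation therefore takes place
in the preferred chart at that point, the one in which `dη` is defined there; the foliation chart
enters through the transition map `τ`, whose second derivatives drop out of `dη` by symmetry.
-/

/-! ### Coordinates on open subsets of vector spaces -/

section Euclidean

variable {E A B : Type*} [NormedAddCommGroup E] [NormedSpace ℝ E] [FiniteDimensional ℝ E]
  [NormedAddCommGroup A] [NormedSpace ℝ A] [FiniteDimensional ℝ A]
  [NormedAddCommGroup B] [NormedSpace ℝ B]

/-- The inverse function theorem for a smooth map, with the domain shrunk so that the inverse is
smooth on the whole target. -/
theorem exists_openPartialHomeomorph_of_fderiv_injective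
    {F : Type*} [NormedAddCommGroup F] [NormedSpace ℝ F] [FiniteDimensional ℝ F]
    {f : E → F} {z₀ : E} {s : Set E} (hs : IsOpen s) (hz₀ : z₀ ∈ s) (hf : ContDiffOn ℝ ∞ f s)
    (hinj : ∀ v, fderiv ℝ f z₀ v = 0 → v = 0) (hdim : Module.finrank ℝ E = Module.finrank ℝ F) :
    ∃ Φ : OpenPartialHomeomorph E F, z₀ ∈ Φ.source ∧ Φ.source ⊆ s ∧ (Φ : E → F) = f ∧
      ContDiffOn ℝ ∞ Φ Φ.source ∧ ContDiffOn ℝ ∞ Φ.symm Φ.target := by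
  have hfs : ∀ z ∈ s, ContDiffAt ℝ ∞ f z := fun z hz => hf.contDiffAt (hs.mem_nhds hz)
  have hinj' : Function.Injective (fderiv ℝ f z₀ : E →ₗ[ℝ] F) :=
    (injective_iff_map_eq_zero _).2 hinj
  let e : E ≃L[ℝ] F :=
    (LinearEquiv.ofInjectiveOfFinrankEq (fderiv ℝ f z₀ : E →ₗ[ℝ] F)
      hinj' hdim).toContinuousLinearEquiv
  have he : (e : E →L[ℝ] F) = fderiv ℝ f z₀ := by
    ext v; rfl
  have hd : HasFDerivAt f (e : E →L[ℝ] F) z₀ := by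
    rw [he]; exact ((hfs z₀ hz₀).differentiableAt (by simp)).hasFDerivAt
  let Ψ := (hfs z₀ hz₀).toOpenPartialHomeomorph f hd (by simp)
  have hev : ∀ᶠ z in 𝓝 z₀, (fderiv ℝ f z) ∈ range ((↑) : (E ≃L[ℝ] F) → E →L[ℝ] F) := by
    have hc : ContinuousAt (fderiv ℝ f) z₀ :=
      ((hfs z₀ hz₀).fderiv_right (m := 0) (by simp)).continuousAt
    apply hc.eventually_mem
    rw [← he]
    exact ContinuousLinearEquiv.nhds e
  obtain ⟨t, ht, hto, hzt⟩ := mem_nhds_iff.1 (Filter.inter_mem (hs.mem_nhds hz₀) hev)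
  refine ⟨Ψ.restrOpen t hto, ⟨(hfs z₀ hz₀).mem_toOpenPartialHomeomorph_source hd _, hzt⟩,
    fun z hz => (ht hz.2).1, rfl, fun z hz => (hfs z (ht hz.2).1).contDiffWithinAt, ?_⟩
  intro w hw
  have hz := (Ψ.restrOpen t hto).map_target hw
  obtain ⟨e', he'⟩ := (ht hz.2).2
  have h1 := hfs _ (ht hz.2).1
  refine ((Ψ.restrOpen t hto).contDiffAt_symm (f₀' := e') hw ?_ h1).contDiffWithinAt
  rw [he']
  exact (h1.differentiableAt (by simp)).hasFDerivAt

theorem finrank_comap_equiv {E F : Type*} [AddCommGroup E] [Module ℝ E] [AddCommGroup F]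
    [Module ℝ F] (e : E ≃ₗ[ℝ] F) (W : Submodule ℝ F) :
    Module.finrank ℝ (W.comap e.toLinearMap) = Module.finrank ℝ W := by
  rw [Submodule.comap_equiv_eq_map_symm, LinearEquiv.finrank_map_eq]

/-- A linear surjection `ℓ` onto `B` whose kernel contains `W` is the second component of a linear
surjection onto `A × B` with kernel exactly `W`, as soon as the dimensions allow it. -/
theorem exists_prod_ker_eq {W : Submodule ℝ E} {ℓ : E →L[ℝ] B} (hℓ : Function.Surjective ℓ)
    (hW : ∀ v ∈ W, ℓ v = 0)
    (hdim : Module.finrank ℝ E = Module.finrank ℝ A + Module.finrank ℝ B + Module.finrank ℝ W) :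
    ∃ Q : E →L[ℝ] A, (∀ v, v ∈ W ↔ Q v = 0 ∧ ℓ v = 0) ∧ Function.Surjective (Q.prod ℓ) := by
  let K := LinearMap.ker (ℓ : E →ₗ[ℝ] B)
  have hWK : W ≤ K := hW
  have hK : Module.finrank ℝ K + Module.finrank ℝ B = Module.finrank ℝ E := by
    have := LinearMap.finrank_range_add_finrank_ker (ℓ : E →ₗ[ℝ] B)
    rw [LinearMap.range_eq_top.2 hℓ, finrank_top, add_comm] at this
    exact this
  let W' : Submodule ℝ K := W.submoduleOf K
  have hW' : Module.finrank ℝ W' = Module.finrank ℝ W :=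
    (Submodule.submoduleOfEquivOfLe hWK).finrank_eq
  have hq : Module.finrank ℝ (K ⧸ W') = Module.finrank ℝ A := by
    have := Submodule.finrank_quotient_add_finrank W'
    omega
  let e : (K ⧸ W') ≃ₗ[ℝ] A := LinearEquiv.ofFinrankEq _ _ hq
  obtain ⟨q, hq⟩ := LinearMap.exists_extend ((e : (K ⧸ W') →ₗ[ℝ] A) ∘ₗ W'.mkQ)
  have hqK : ∀ v (hv : v ∈ K), q v = e (W'.mkQ ⟨v, hv⟩) := fun v hv =>
    congrArg (fun T : K →ₗ[ℝ] A => T ⟨v, hv⟩) hq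
  have hker : ∀ v (hv : v ∈ K), v ∈ W ↔ q v = 0 := fun v hv => by
    rw [hqK v hv, e.map_eq_zero_iff, Submodule.mkQ_apply, Submodule.Quotient.mk_eq_zero]
    rfl
  refine ⟨LinearMap.toContinuousLinearMap q, fun v => ⟨fun h => ⟨(hker v (hW v h)).1 h, hW v h⟩,
    fun h => (hker v h.2).2 h.1⟩, ?_⟩
  rintro ⟨a, b⟩
  obtain ⟨u, rfl⟩ := hℓ b
  obtain ⟨⟨v, hv⟩, hv'⟩ := (e.surjective.comp W'.mkQ_surjective) (a - q u)
  refine ⟨u + v, Prod.ext ?_ ?_⟩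
  · change q (u + v) = a
    rw [map_add, hqK v hv]
    exact (congrArg (q u + ·) hv').trans (by abel)
  · change ℓ (u + v) = ℓ u
    rw [map_add, show ℓ v = 0 from hv, add_zero]


/-- The theorem in coordinates. `τ` stands for coordinates in which the foliation is parallel to
`W`, and `α` for a `B`-valued one-form vanishing on the foliation, surjective at `z₀`, with `dα`
nondegenerate on `ker α` at `z₀`. Then there are coordinates `(x, y, p)` near `z₀` in which
`ker α` is the Cartan distribution `dy = p dx` and the leaves are the fibres of `(x, y)`. -/
theorem exists_jet_coordinates [FiniteDimensional ℝ B] {O : Set E} (hO : IsOpen O)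
    {z₀ : E} (hz₀ : z₀ ∈ O)
    {α : E → E →L[ℝ] B} (hα : ContDiffOn ℝ ∞ α O) {τ : E → E} (hτ : ContDiffOn ℝ ∞ τ O)
    (hτ' : ∀ z ∈ O, ∀ v, fderiv ℝ τ z v = 0 → v = 0) {W : Submodule ℝ E}
    (hW : ∀ z ∈ O, ∀ v, fderiv ℝ τ z v ∈ W → α z v = 0)
    (hdimW : Module.finrank ℝ W = Module.finrank ℝ A * Module.finrank ℝ B)
    (hdim : Module.finrank ℝ E = Module.finrank ℝ A + Module.finrank ℝ B + Module.finrank ℝ W)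
    (hsurj : Function.Surjective (α z₀))
    (hnondeg : ∀ v, α z₀ v = 0 → (∀ w, α z₀ w = 0 → fderiv ℝ α z₀ v w = fderiv ℝ α z₀ w v) →
      v = 0) :
    ∃ Φ : OpenPartialHomeomorph E ((A × B) × (A →L[ℝ] B)), z₀ ∈ Φ.source ∧ Φ.source ⊆ O ∧
      ContDiffOn ℝ ∞ Φ Φ.source ∧ ContDiffOn ℝ ∞ Φ.symm Φ.target ∧
      ∀ z ∈ Φ.source, ∀ v,
        (α z v = 0 ↔ (fderiv ℝ Φ z v).1.2 = (Φ z).2 (fderiv ℝ Φ z v).1.1) ∧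
        (fderiv ℝ τ z v ∈ W ↔ (fderiv ℝ Φ z v).1 = 0) := by
  have hτd : ContDiffOn ℝ ∞ (fderiv ℝ τ) O := hτ.fderiv_of_isOpen hO (by simp)
  have hequiv : ∀ z ∈ O, ∃ e : E ≃L[ℝ] E, (e : E →L[ℝ] E) = fderiv ℝ τ z := fun z hz =>
    ⟨(LinearEquiv.ofInjectiveOfFinrankEq (fderiv ℝ τ z : E →ₗ[ℝ] E)
      ((injective_iff_map_eq_zero _).2 (hτ' z hz)) rfl).toContinuousLinearEquiv, by ext v; rfl⟩
  -- `γ` is the one-form `α` read in the foliation coordinates `τ`; it vanishes on `W`.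
  let γ : E → E →L[ℝ] B := fun z => (α z).comp (fderiv ℝ τ z).inverse
  have hγτ : ∀ z ∈ O, ∀ v, γ z (fderiv ℝ τ z v) = α z v := fun z hz v => by
    obtain ⟨e, he⟩ := hequiv z hz
    simp [γ, ← he]
  have hγW : ∀ z ∈ O, ∀ u ∈ W, γ z u = 0 := fun z hz u hu => by
    obtain ⟨e, he⟩ := hequiv z hz
    have : u = fderiv ℝ τ z (e.symm u) := by simp [← he]
    rw [this] at hu ⊢
    rw [hγτ z hz, hW z hz _ hu]
  have hγs : ContDiffOn ℝ ∞ γ O := fun z hz => by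
    obtain ⟨e, he⟩ := hequiv z hz
    have h1 : ContDiffAt ℝ ∞ (ContinuousLinearMap.inverse : (E →L[ℝ] E) → _) (fderiv ℝ τ z) := by
      rw [← he]; exact contDiffAt_map_inverse e
    exact (hα z hz).clm_comp (h1.comp_contDiffWithinAt z (hτd z hz))
  have hℓ : Function.Surjective (γ z₀) := fun b => by
    obtain ⟨v, rfl⟩ := hsurj b
    exact ⟨_, hγτ z₀ hz₀ v⟩
  -- With `γ z₀` as second component of the projection to the leaf space, `βB z₀` is the identity,
  -- so that near `z₀` the kernel of `β z` is the graph of a map `G z : A →L[ℝ] B`.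
  obtain ⟨Q, hQW, hQ⟩ := exists_prod_ker_eq (A := A) hℓ (hγW z₀ hz₀) hdim
  set P : E →L[ℝ] A × B := Q.prod (γ z₀) with hP
  have hPW : ∀ v, v ∈ W ↔ P v = 0 := fun v => by
    rw [hQW]; simp [hP]
  obtain ⟨S₀, hS₀⟩ := LinearMap.exists_rightInverse_of_surjective (P : E →ₗ[ℝ] A × B)
    (LinearMap.range_eq_top.2 hQ)
  let S : A × B →L[ℝ] E := LinearMap.toContinuousLinearMap S₀
  have hS : ∀ c, P (S c) = c := fun c => congrArg (fun T : A × B →ₗ[ℝ] A × B => T c) hS₀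
  -- `β` is the family of `B`-valued covectors on the leaf space `A × B` through which `α` factors.
  let β : E → A × B →L[ℝ] B := fun z => (γ z).comp S
  have hβs : ContDiffOn ℝ ∞ β O := hγs.clm_comp contDiffOn_const
  have hβ : ∀ z ∈ O, ∀ v, α z v = β z (P (fderiv ℝ τ z v)) := fun z hz v => by
    rw [← hγτ z hz, ← sub_eq_zero]
    change γ z _ - γ z _ = 0
    rw [← map_sub]
    apply hγW z hz
    rw [hPW, map_sub]
    exact sub_eq_zero.2 (hS _).symm
  let βA : E → A →L[ℝ] B := fun z => (β z).comp (ContinuousLinearMap.inl ℝ A B)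
  let βB : E → B →L[ℝ] B := fun z => (β z).comp (ContinuousLinearMap.inr ℝ A B)
  have hβAB : ∀ z c, β z c = βA z c.1 + βB z c.2 := fun z c => by
    simp only [βA, βB, ContinuousLinearMap.comp_apply, ← map_add]
    simp
  have hβAs : ContDiffOn ℝ ∞ βA O := hβs.clm_comp contDiffOn_const
  have hβBs : ContDiffOn ℝ ∞ βB O := hβs.clm_comp contDiffOn_const
  have hβB₀ : βB z₀ = 1 := by
    ext b
    change γ z₀ (S (0, b)) = b
    exact congrArg Prod.snd (hS (0, b))
  let O' : Set E := O ∩ βB ⁻¹' {T | IsUnit T}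
  have hO' : IsOpen O' := hβBs.continuousOn.isOpen_inter_preimage hO Units.isOpen
  have hz₀' : z₀ ∈ O' := ⟨hz₀, by simp [hβB₀]⟩
  let G : E → A →L[ℝ] B := fun z => -(Ring.inverse (βB z)).comp (βA z)
  have hGs : ContDiffOn ℝ ∞ G O' := fun z hz => by
    obtain ⟨u, hu⟩ := hz.2
    have h1 : ContDiffAt ℝ ∞ (Ring.inverse : (B →L[ℝ] B) → _) (βB z) := by
      rw [← hu]; exact contDiffAt_ringInverse ℝ u
    exact ((h1.comp_contDiffWithinAt z ((hβBs z hz.1).mono inter_subset_left)).clm_comp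
      ((hβAs z hz.1).mono inter_subset_left)).neg
  have hinv : ∀ z ∈ O', ∀ b, βB z (Ring.inverse (βB z) b) = b ∧ Ring.inverse (βB z) (βB z b) = b :=
    fun z hz b => ⟨congrArg (fun T : B →L[ℝ] B => T b) (Ring.mul_inverse_cancel _ hz.2),
      congrArg (fun T : B →L[ℝ] B => T b) (Ring.inverse_mul_cancel _ hz.2)⟩
  have hβG : ∀ z ∈ O', ∀ c, β z c = 0 ↔ c.2 = G z c.1 := fun z hz c => by
    have h1 : G z c.1 = - Ring.inverse (βB z) (βA z c.1) := rfl
    rw [hβAB, h1]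
    constructor
    · intro h
      rw [eq_neg_of_add_eq_zero_left h, map_neg, neg_neg, (hinv z hz _).2]
    · intro h
      rw [h, map_neg, (hinv z hz _).1, add_neg_cancel]
  let F : E → (A × B) × (A →L[ℝ] B) := fun z => (P (τ z), G z)
  have hτs' : ContDiffOn ℝ ∞ τ O' := hτ.mono inter_subset_left
  have hFs : ContDiffOn ℝ ∞ F O' := (P.contDiff.comp_contDiffOn hτs').prodMk hGs
  have hF' : ∀ z ∈ O', ∀ v, fderiv ℝ F z v = (P (fderiv ℝ τ z v), fderiv ℝ G z v) := by
    intro z hz v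
    have h1 : HasFDerivAt τ (fderiv ℝ τ z) z :=
      ((hτs'.contDiffAt (hO'.mem_nhds hz)).differentiableAt (by simp)).hasFDerivAt
    have h2 : HasFDerivAt G (fderiv ℝ G z) z :=
      ((hGs.contDiffAt (hO'.mem_nhds hz)).differentiableAt (by simp)).hasFDerivAt
    have h3 : HasFDerivAt F _ z := (P.hasFDerivAt.comp z h1).prodMk h2
    rw [h3.fderiv]
    rfl
  -- If `v` is tangent to the leaf and `dG(v) = 0`, then `dα(v, w) = 0` for all `w ∈ ker α`, so that
  -- nondegeneracy gives `v = 0`.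
  have hinj : ∀ v, fderiv ℝ F z₀ v = 0 → v = 0 := by
    intro v hv
    rw [hF' z₀ hz₀'] at hv
    have hvP : P (fderiv ℝ τ z₀ v) = 0 := congrArg Prod.fst hv
    have hvG : fderiv ℝ G z₀ v = 0 := congrArg Prod.snd hv
    have hdβ : HasFDerivAt β (fderiv ℝ β z₀) z₀ :=
      ((hβs.contDiffAt (hO.mem_nhds hz₀)).differentiableAt (by simp)).hasFDerivAt
    have hdG : HasFDerivAt G (fderiv ℝ G z₀) z₀ :=
      ((hGs.contDiffAt (hO'.mem_nhds hz₀')).differentiableAt (by simp)).hasFDerivAt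
    have hdτ : HasFDerivAt (fderiv ℝ τ) (fderiv ℝ (fderiv ℝ τ) z₀) z₀ :=
      ((hτd.contDiffAt (hO.mem_nhds hz₀)).differentiableAt (by simp)).hasFDerivAt
    have hsymm : IsSymmSndFDerivAt ℝ τ z₀ :=
      (hτ.contDiffAt (hO.mem_nhds hz₀)).isSymmSndFDerivAt
        (by simpa using WithTop.coe_le_coe.2 (le_top : (2 : ℕ∞) ≤ ⊤))
    have hdα : ∀ u w, fderiv ℝ α z₀ u w =
        fderiv ℝ β z₀ u (P (fderiv ℝ τ z₀ w)) + β z₀ (P (fderiv ℝ (fderiv ℝ τ) z₀ u w)) := by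
      intro u w
      have h1 : HasFDerivAt (fun z => (β z).comp (P.comp (fderiv ℝ τ z))) _ z₀ :=
        hdβ.clm_comp ((hasFDerivAt_const P z₀).clm_comp hdτ)
      have h2 : α =ᶠ[𝓝 z₀] fun z => (β z).comp (P.comp (fderiv ℝ τ z)) := by
        filter_upwards [hO.mem_nhds hz₀] with z hz
        ext v
        exact hβ z hz v
      rw [h2.fderiv_eq, h1.fderiv]
      simp [add_comm]
    -- Differentiate the identity `β z (a, G z a) = 0` in the direction `v`.
    have hdβv : ∀ a, fderiv ℝ β z₀ v (a, G z₀ a) = 0 := by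
      intro a
      have h1 : HasFDerivAt (fun z => β z (a, G z a)) _ z₀ :=
        hdβ.clm_apply ((hasFDerivAt_const a z₀).prodMk (hdG.clm_apply (hasFDerivAt_const a z₀)))
      have h2 : (fun z => β z (a, G z a)) =ᶠ[𝓝 z₀] fun _ => 0 := by
        filter_upwards [hO'.mem_nhds hz₀'] with z hz
        exact (hβG z hz _).2 rfl
      have h3 := congrArg (fun T : E →L[ℝ] B => T v) (h1.fderiv.symm.trans h2.fderiv_eq)
      simpa [hvG, show ((0 : A), (0 : B)) = 0 from rfl] using h3
    refine hnondeg v (by rw [hβ z₀ hz₀, hvP, map_zero]) fun w hw => ?_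
    rw [hβ z₀ hz₀] at hw
    have h1 := (hβG z₀ hz₀' _).1 hw
    have h2 := hdβv (P (fderiv ℝ τ z₀ w)).1
    rw [← h1] at h2
    -- The second derivatives of `τ` cancel in `dα`, and `v` is tangent to the leaf.
    rw [hdα, hdα, hvP, map_zero, zero_add, hsymm.eq v w]
    exact (congrArg (· + _) h2).trans (zero_add _)
  obtain ⟨Φ, hΦ₀, hΦO, hΦF, hΦs, hΦs'⟩ := exists_openPartialHomeomorph_of_fderiv_injective hO'
    hz₀' hFs hinj (by
      have := LinearMap.toContinuousLinearMap (𝕜 := ℝ) (E := A) (F' := B) |>.finrank_eq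
      rw [Module.finrank_prod, Module.finrank_prod, ← this, Module.finrank_linearMap, hdim, hdimW])
  refine ⟨Φ, hΦ₀, fun z hz => (hΦO hz).1, hΦs, hΦs', fun z hz v => ?_⟩
  have hz' := hΦO hz
  rw [hΦF, hF' z hz', hPW, hβ z hz'.1]
  exact ⟨hβG z hz' _, Iff.rfl⟩

end Euclidean

/-! ### Jets of sections of a trivial bundle -/

section Jets

variable (A B : Type*) [NormedAddCommGroup A] [NormedSpace ℝ A]
  [NormedAddCommGroup B] [NormedSpace ℝ B]

/-- The product projection `A × B → A`, as a smooth fibre bundle with typical fibre `B`. -/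
def SmoothFibreBundle.trivial : SmoothFibreBundle A B A B (A × B) where
  proj := Prod.fst
  contMDiff_proj := contDiff_fst.contMDiff
  surjective_proj := Prod.fst_surjective
  exists_trivialization x := by
    refine ⟨{ toOpenPartialHomeomorph := OpenPartialHomeomorph.refl (A × B)
              baseSet := univ
              open_baseSet := isOpen_univ
              source_eq := by simp
              target_eq := by simp
              proj_toFun := fun _ _ => rfl }, mem_univ x, ?_, ?_⟩
    · exact (contDiff_fst.contMDiff.prodMk contDiff_snd.contMDiff).contMDiffOn
    · exact (contMDiff_fst.prodMk_space contMDiff_snd).contMDiffOn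

namespace SmoothFibreBundle.trivial

/-- The identity of `A × B`, as adapted coordinates of the trivial bundle. -/
def adaptedChart : AdaptedChart (SmoothFibreBundle.trivial A B) where
  base := OpenPartialHomeomorph.refl A
  total := OpenPartialHomeomorph.refl (A × B)
  base_smooth := contMDiffOn_id
  base_symm_smooth := contMDiffOn_id
  total_smooth := contMDiffOn_id
  total_symm_smooth := contMDiffOn_id
  proj_mem _ _ := mem_univ _
  total_fst _ _ := rfl

instance : Nonempty (Jet1 (SmoothFibreBundle.trivial A B)) :=
  ⟨(adaptedChart A B).jetOfCoord 0 (mem_univ _) 0⟩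

theorem jetChart_mem_atlas : (adaptedChart A B).jetChart ∈
    (Jet1.chartedSpaceCore (SmoothFibreBundle.trivial A B)).atlas :=
  ⟨adaptedChart A B, inferInstance, rfl⟩

/-- The global chart `(x, y, p)` of the jet manifold of the trivial bundle. -/
noncomputable def jetChart : OpenPartialHomeomorph (Jet1 (SmoothFibreBundle.trivial A B))
    ((A × B) × (A →L[ℝ] B)) :=
  (Jet1.chartedSpaceCore (SmoothFibreBundle.trivial A B)).openPartialHomeomorph _
    (jetChart_mem_atlas A B)

theorem jetChart_mem_maximalAtlas : jetChart A B ∈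
    IsManifold.maximalAtlas 𝓘(ℝ, (A × B) × (A →L[ℝ] B)) ∞
      (Jet1 (SmoothFibreBundle.trivial A B)) :=
  IsManifold.subset_maximalAtlas
    (mem_iUnion₂.2 ⟨_, jetChart_mem_atlas A B, rfl⟩)

theorem jetChart_source : (jetChart A B).source = univ := eq_univ_of_forall fun j => mem_univ j.pt

theorem jetChart_target : (jetChart A B).target = univ :=
  eq_univ_of_forall fun _ => ⟨mem_univ _, mem_univ _⟩

variable {A B}

/-- The jet with coordinates `(x, y, p)` has as image the graph of `p`. -/
theorem lin_eq (j : Jet1 (SmoothFibreBundle.trivial A B)) (a : A) :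
    (j.lin a : A × B) = (a, (jetChart A B j).2 a) := by
  have h1 : (mfderiv 𝓘(ℝ, A × B) 𝓘(ℝ, A) (Prod.fst : A × B → A) j.pt : A × B →L[ℝ] A) =
      ContinuousLinearMap.fst ℝ A B := by
    rw [mfderiv_eq_fderiv, fderiv_fst]
  have h2 : (adaptedChart A B).dTotal j.pt = ContinuousLinearMap.id ℝ (A × B) := mfderiv_id
  have h3 : (adaptedChart A B).dBaseSymm j.pt = ContinuousLinearMap.id ℝ A := mfderiv_id
  refine Prod.ext ?_ ?_
  · exact (congrArg (fun T : A × B →L[ℝ] A => T (j.lin a)) h1).symm.trans (j.mfderiv_lin a)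
  · change _ = ((adaptedChart A B).dTotal j.pt
      ((j.lin : A →L[ℝ] A × B) ((adaptedChart A B).dBaseSymm j.pt a))).2
    rw [h2, h3]
    rfl

/-- Differential of the chart `(x, y, p)`, with the tangent spaces spelled out as the model space. -/
noncomputable def dJetChart (j : Jet1 (SmoothFibreBundle.trivial A B)) :
    (A × B) × (A →L[ℝ] B) →L[ℝ] (A × B) × (A →L[ℝ] B) :=
  mfderiv 𝓘(ℝ, (A × B) × (A →L[ℝ] B)) 𝓘(ℝ, (A × B) × (A →L[ℝ] B)) (jetChart A B) j

theorem mdifferentiableAt_jetChart (j : Jet1 (SmoothFibreBundle.trivial A B)) :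
    MDifferentiableAt 𝓘(ℝ, (A × B) × (A →L[ℝ] B)) 𝓘(ℝ, (A × B) × (A →L[ℝ] B))
      (jetChart A B) j :=
  (contMDiffAt_of_mem_maximalAtlas (jetChart_mem_maximalAtlas A B)
    (by rw [jetChart_source]; exact mem_univ _)).mdifferentiableAt (by simp)

theorem mfderiv_pt (j : Jet1 (SmoothFibreBundle.trivial A B)) :
    (mfderiv 𝓘(ℝ, (A × B) × (A →L[ℝ] B)) 𝓘(ℝ, A × B)
      (Jet1.pt : Jet1 (SmoothFibreBundle.trivial A B) → A × B) j :
      (A × B) × (A →L[ℝ] B) →L[ℝ] A × B) =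
      (ContinuousLinearMap.fst ℝ (A × B) (A →L[ℝ] B)).comp (dJetChart j) := by
  have h := mfderiv_comp (I'' := 𝓘(ℝ, A × B)) (g := (Prod.fst : (A × B) × (A →L[ℝ] B) → A × B)) j
    differentiableAt_fst.mdifferentiableAt (mdifferentiableAt_jetChart j)
  rw [mfderiv_eq_fderiv, fderiv_fst] at h
  exact h

/-- In the coordinates `(x, y, p)` the Cartan distribution is `dy = p dx`. -/
theorem mem_cartan_iff (j : Jet1 (SmoothFibreBundle.trivial A B))
    (w : TangentSpace 𝓘(ℝ, (A × B) × (A →L[ℝ] B)) j) :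
    w ∈ j.cartan ↔ (dJetChart j w).1.2 = (jetChart A B j).2 (dJetChart j w).1.1 := by
  have h : ∀ u : A × B, (∃ a : A, (j.lin a : A × B) = u) ↔ u.2 = (jetChart A B j).2 u.1 := by
    intro u
    simp only [lin_eq]
    constructor
    · rintro ⟨a, rfl⟩; rfl
    · intro hu
      exact ⟨u.1, Prod.ext rfl hu.symm⟩
  refine Iff.trans (Iff.of_eq ?_) (h (dJetChart j w).1)
  change (∃ a : A, (j.lin a : A × B) =
    (mfderiv 𝓘(ℝ, (A × B) × (A →L[ℝ] B)) 𝓘(ℝ, A × B)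
      (Jet1.pt : Jet1 (SmoothFibreBundle.trivial A B) → A × B) j :
      (A × B) × (A →L[ℝ] B) →L[ℝ] A × B) w) = _
  rw [mfderiv_pt]
  rfl

theorem mem_vertical_iff (j : Jet1 (SmoothFibreBundle.trivial A B))
    (w : TangentSpace 𝓘(ℝ, (A × B) × (A →L[ℝ] B)) j) :
    w ∈ j.vertical ↔ (dJetChart j w).1 = 0 := by
  change (mfderiv 𝓘(ℝ, (A × B) × (A →L[ℝ] B)) 𝓘(ℝ, A × B)
      (Jet1.pt : Jet1 (SmoothFibreBundle.trivial A B) → A × B) j :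
      (A × B) × (A →L[ℝ] B) →L[ℝ] A × B) w = 0 ↔ _
  rw [mfderiv_pt]
  rfl

end SmoothFibreBundle.trivial

end Jets

/-! ### `k`-contact forms in charts -/

section ContactForms

variable {m k : ℕ} {M : Type*} [TopologicalSpace M] [ChartedSpace (EuclideanSpace ℝ (Fin m)) M]
  [IsManifold (𝓡 m) ∞ M]

/-- Differential at `y` of the preferred chart at `x`, with the tangent space at `y` spelled out as
the model space. -/
noncomputable def dChart (x y : M) : EuclideanSpace ℝ (Fin m) →L[ℝ] EuclideanSpace ℝ (Fin m) :=
  mfderiv (𝓡 m) (𝓡 m) (chartAt (EuclideanSpace ℝ (Fin m)) x) y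

theorem mfderiv_symm_dChart {x y : M} (hy : y ∈ (chartAt (EuclideanSpace ℝ (Fin m)) x).source)
    (v : EuclideanSpace ℝ (Fin m)) :
    (mfderiv (𝓡 m) (𝓡 m) (chartAt (EuclideanSpace ℝ (Fin m)) x).symm
      (chartAt (EuclideanSpace ℝ (Fin m)) x y) :
        EuclideanSpace ℝ (Fin m) →L[ℝ] EuclideanSpace ℝ (Fin m)) (dChart x y v) = v := by
  have : IsManifold (𝓡 m) 1 M := IsManifold.of_le (n := ∞) (by simp)
  exact congrArg (fun T : EuclideanSpace ℝ (Fin m) →L[ℝ] EuclideanSpace ℝ (Fin m) => T v)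
    ((mdifferentiable_chart (I := 𝓡 m) x).symm_comp_deriv hy)

theorem dChart_surjective {x y : M} (hy : y ∈ (chartAt (EuclideanSpace ℝ (Fin m)) x).source) :
    Function.Surjective (dChart (m := m) x y) := by
  have : IsManifold (𝓡 m) 1 M := IsManifold.of_le (n := ∞) (by simp)
  exact (mdifferentiable_chart (I := 𝓡 m) x).mfderiv_surjective hy

theorem mfderiv_eq_fderiv_dChart {G : Type*} [NormedAddCommGroup G] [NormedSpace ℝ G]
    {x y : M} (hy : y ∈ (chartAt (EuclideanSpace ℝ (Fin m)) x).source)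
    {f : M → G} {g : EuclideanSpace ℝ (Fin m) → G}
    (hg : DifferentiableAt ℝ g (chartAt (EuclideanSpace ℝ (Fin m)) x y))
    (hfg : f =ᶠ[𝓝 y] g ∘ chartAt (EuclideanSpace ℝ (Fin m)) x) (v : TangentSpace (𝓡 m) y) :
    (mfderiv (𝓡 m) 𝓘(ℝ, G) f y : EuclideanSpace ℝ (Fin m) →L[ℝ] G) v =
      fderiv ℝ g (chartAt (EuclideanSpace ℝ (Fin m)) x y) (dChart x y v) := by
  have : IsManifold (𝓡 m) 1 M := IsManifold.of_le (n := ∞) (by simp)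
  have h := mfderiv_comp (I'' := 𝓘(ℝ, G)) y hg.mdifferentiableAt
    ((mdifferentiable_chart (I := 𝓡 m) x).mdifferentiableAt hy)
  rw [mfderiv_eq_fderiv] at h
  rw [hfg.mfderiv_eq]
  exact congrArg (fun T : EuclideanSpace ℝ (Fin m) →L[ℝ] G => T v) h

namespace VectorOneForm

variable {η : VectorOneForm m k M} {U : Set M}

/-- `inChart` is indeed the pullback of `η` by the inverse chart. -/
theorem inChart_dChart (η : VectorOneForm m k M) {x y : M}
    (hy : y ∈ (chartAt (EuclideanSpace ℝ (Fin m)) x).source) (v : TangentSpace (𝓡 m) y) :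
    η.inChart x (chartAt (EuclideanSpace ℝ (Fin m)) x y) (dChart x y v) = η y v := by
  change (η ((chartAt (EuclideanSpace ℝ (Fin m)) x).symm (chartAt (EuclideanSpace ℝ (Fin m)) x y)) :
    EuclideanSpace ℝ (Fin m) →L[ℝ] EuclideanSpace ℝ (Fin k))
    ((mfderiv (𝓡 m) (𝓡 m) (chartAt (EuclideanSpace ℝ (Fin m)) x).symm
      (chartAt (EuclideanSpace ℝ (Fin m)) x y) :
        EuclideanSpace ℝ (Fin m) →L[ℝ] EuclideanSpace ℝ (Fin m)) (dChart x y v)) = _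
  refine (congrArg (η _) (mfderiv_symm_dChart hy v)).trans ?_
  exact congrArg (fun p => (η p : EuclideanSpace ℝ (Fin m) →L[ℝ] EuclideanSpace ℝ (Fin k)) v)
    ((chartAt (EuclideanSpace ℝ (Fin m)) x).left_inv hy)

omit [IsManifold (𝓡 m) ∞ M] in
theorem extD_apply (η : VectorOneForm m k M) (x : M) (v w : TangentSpace (𝓡 m) x) :
    η.extD x v w =
      fderiv ℝ (η.inChart x) (chartAt (EuclideanSpace ℝ (Fin m)) x x) (dChart x x v)
        (dChart x x w) -
      fderiv ℝ (η.inChart x) (chartAt (EuclideanSpace ℝ (Fin m)) x x) (dChart x x w)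
        (dChart x x v) := rfl

/-- The trivialisation of the bundle `Hom(TM, M × ℝᵏ)` at `x` sends `η` to its expression in the
chart at `x`, so that the latter is smooth. -/
theorem IsSmoothOn.contDiffOn_inChart (hη : η.IsSmoothOn U) (hU : IsOpen U) (x : M) :
    ContDiffOn ℝ ∞ (η.inChart x) ((chartAt (EuclideanSpace ℝ (Fin m)) x).target ∩
      (chartAt (EuclideanSpace ℝ (Fin m)) x).symm ⁻¹' U) := by
  have : IsManifold (𝓡 m) 1 M := IsManifold.of_le (n := ∞) (by simp)
  let φ := chartAt (EuclideanSpace ℝ (Fin m)) x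
  let e := trivializationAt (EuclideanSpace ℝ (Fin m) →L[ℝ] EuclideanSpace ℝ (Fin k))
    (fun x : M => TangentSpace (𝓡 m) x →L[ℝ] Bundle.Trivial M (EuclideanSpace ℝ (Fin k)) x) x
  have hs : U ∩ φ.source ⊆ e.baseSet := fun y hy => ⟨hy.2, mem_univ y⟩
  have h1 := (e.contMDiffOn_section_iff (IB := 𝓡 m) (n := ∞) (s := η)
    (hU.inter φ.open_source) hs).1 (ContMDiffOn.mono hη inter_subset_left)
  have h2 : ContMDiffOn (𝓡 m) (𝓡 m) ∞ φ.symm φ.target := contMDiffOn_chart_symm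
  rw [← contMDiffOn_iff_contDiffOn]
  refine (h1.comp (h2.mono inter_subset_left) fun z hz => ⟨hz.2, φ.map_target hz.1⟩).congr ?_
  intro z hz
  have h3 : ((trivializationAt (EuclideanSpace ℝ (Fin m)) (TangentSpace (𝓡 m)) x).symmL ℝ
      (φ.symm z) : EuclideanSpace ℝ (Fin m) →L[ℝ] EuclideanSpace ℝ (Fin m)) =
      mfderiv (𝓡 m) (𝓡 m) φ.symm z := by
    have h4 := TangentBundle.symmL_trivializationAt (I := 𝓡 m) (φ.map_target hz.1)
    rw [ModelWithCorners.range_eq_univ, mfderivWithin_univ,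
      show extChartAt (𝓡 m) x (φ.symm z) = z from φ.right_inv hz.1] at h4
    exact h4
  have h5 : ((trivializationAt (EuclideanSpace ℝ (Fin k))
      (Bundle.Trivial M (EuclideanSpace ℝ (Fin k))) x).continuousLinearMapAt ℝ (φ.symm z) :
        EuclideanSpace ℝ (Fin k) →L[ℝ] EuclideanSpace ℝ (Fin k)) =
      ContinuousLinearMap.id ℝ (EuclideanSpace ℝ (Fin k)) :=
    Bundle.Trivial.continuousLinearMapAt_trivialization ℝ M _ _
  have h6 : ∀ (S : EuclideanSpace ℝ (Fin k) →L[ℝ] EuclideanSpace ℝ (Fin k))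
      (T : EuclideanSpace ℝ (Fin m) →L[ℝ] EuclideanSpace ℝ (Fin m)),
      S = ContinuousLinearMap.id ℝ _ → T = mfderiv (𝓡 m) (𝓡 m) φ.symm z →
      η.inChart x z = S.comp
        ((η (φ.symm z) : EuclideanSpace ℝ (Fin m) →L[ℝ] EuclideanSpace ℝ (Fin k)).comp T) := by
    rintro S T rfl rfl
    rfl
  exact h6 _ _ h5 h3

end VectorOneForm

namespace IsKContactFormOn

variable {η : VectorOneForm m k M} {U : Set M}

theorem finrank_ker_add (h : IsKContactFormOn η U) {x : M} (hx : x ∈ U) :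
    Module.finrank ℝ (η.ker x) + k = m := by
  obtain ⟨r, -, hr, hreg⟩ := h.ker_regular
  rw [hreg.rank_eq x hx, hr]

theorem surjective (h : IsKContactFormOn η U) {x : M} (hx : x ∈ U) :
    Function.Surjective (η x) := by
  let T : EuclideanSpace ℝ (Fin m) →ₗ[ℝ] EuclideanSpace ℝ (Fin k) := (η x).toLinearMap
  have h1 : Module.finrank ℝ (LinearMap.ker T) + k = m := h.finrank_ker_add hx
  have h2 := LinearMap.finrank_range_add_finrank_ker T
  rw [finrank_euclideanSpace_fin] at h2
  have h3 : LinearMap.range T = ⊤ := by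
    apply Submodule.eq_top_of_finrank_eq
    rw [finrank_euclideanSpace_fin]
    omega
  exact LinearMap.range_eq_top.1 h3

/-- The form `dη` is nondegenerate on `ker η`: since `ker η` and `ker dη` are complementary for
dimension reasons, a vector of `ker η` which is `dη`-orthogonal to `ker η` lies in `ker dη`. -/
theorem nondegenerate (h : IsKContactFormOn η U) {x : M} (hx : x ∈ U)
    {v : TangentSpace (𝓡 m) x} (hv : η x v = 0) (hvw : ∀ w, η x w = 0 → η.extD x v w = 0) :
    v = 0 := by
  have hcompl : IsCompl (η.ker x) (η.kerExtD x) := by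
    have hd : Disjoint (η.ker x) (η.kerExtD x) := disjoint_iff.2 (h.inf_eq_bot x hx)
    refine ⟨hd, codisjoint_iff.2 ?_⟩
    have : FiniteDimensional ℝ (TangentSpace (𝓡 m) x) :=
      inferInstanceAs (FiniteDimensional ℝ (EuclideanSpace ℝ (Fin m)))
    refine Submodule.eq_top_of_disjoint _ _ ?_ hd
    rw [h.kerExtD_regular.rank_eq x hx, h.finrank_ker_add hx]
    exact (finrank_euclideanSpace_fin (𝕜 := ℝ) (n := m)).le
  have hmem : v ∈ η.ker x ⊓ η.kerExtD x := by
    refine ⟨hv, ?_⟩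
    change η.extD x v = 0
    ext1 w
    obtain ⟨w₁, hw₁, w₂, hw₂, rfl⟩ := Submodule.mem_sup.1
      (hcompl.sup_eq_top ▸ Submodule.mem_top : w ∈ η.ker x ⊔ η.kerExtD x)
    have h2 : η.extD x w₂ v = 0 := congrArg
      (fun T : TangentSpace (𝓡 m) x →L[ℝ] EuclideanSpace ℝ (Fin k) => T v) (hw₂ : η.extD x w₂ = 0)
    rw [map_add, hvw w₁ hw₁, zero_add, VectorOneForm.extD_apply, ← neg_sub,
      ← VectorOneForm.extD_apply, h2, neg_zero]
    rfl
  rw [h.inf_eq_bot x hx] at hmem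
  exact hmem

end IsKContactFormOn

end ContactForms

/-! ### Polarised `k`-contact manifolds are locally jet manifolds -/

section Main

variable {n k m : ℕ} {M : Type*} [TopologicalSpace M]
  [ChartedSpace (EuclideanSpace ℝ (Fin m)) M] [IsManifold (𝓡 m) ∞ M]

/-- Near every point there are coordinates `(x, y, p)` in which `D` is `dy = p dx` and `V` is
`dx = dy = 0`. They are written as functions of the preferred chart at the point, in which `dη` is
computed. -/
theorem IsPolarisedKContact.exists_coordinates {D V : TangentDistribution m M}
    (hDV : IsPolarisedKContact n k D V) (x : M) :
    ∃ Φ : OpenPartialHomeomorph (EuclideanSpace ℝ (Fin m))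
        ((EuclideanSpace ℝ (Fin n) × EuclideanSpace ℝ (Fin k)) ×
          (EuclideanSpace ℝ (Fin n) →L[ℝ] EuclideanSpace ℝ (Fin k))),
      chartAt (EuclideanSpace ℝ (Fin m)) x x ∈ Φ.source ∧
      Φ.source ⊆ (chartAt (EuclideanSpace ℝ (Fin m)) x).target ∧
      ContDiffOn ℝ ∞ Φ Φ.source ∧ ContDiffOn ℝ ∞ Φ.symm Φ.target ∧
      ∀ y ∈ (chartAt (EuclideanSpace ℝ (Fin m)) x).source,
        chartAt (EuclideanSpace ℝ (Fin m)) x y ∈ Φ.source → ∀ v : TangentSpace (𝓡 m) y,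
          (v ∈ D y ↔
            (fderiv ℝ Φ (chartAt (EuclideanSpace ℝ (Fin m)) x y) (dChart x y v)).1.2 =
              (Φ (chartAt (EuclideanSpace ℝ (Fin m)) x y)).2
                (fderiv ℝ Φ (chartAt (EuclideanSpace ℝ (Fin m)) x y) (dChart x y v)).1.1) ∧
          (v ∈ V y ↔
            (fderiv ℝ Φ (chartAt (EuclideanSpace ℝ (Fin m)) x y) (dChart x y v)).1 = 0) := by
  let φ := chartAt (EuclideanSpace ℝ (Fin m)) x
  obtain ⟨U, hU, hxU, η, hη, hD⟩ := hDV.kContact x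
  obtain ⟨ψ, hψ, hxψ, W, hW⟩ := hDV.integrable x
  have hxφ : x ∈ φ.source := mem_chart_source _ x
  have hψs := contMDiffOn_of_mem_maximalAtlas hψ
  have hψs' := contMDiffOn_symm_of_mem_maximalAtlas hψ
  have hψd : ψ.MDifferentiable (𝓡 m) (𝓡 m) :=
    ⟨hψs.mdifferentiableOn (by simp), hψs'.mdifferentiableOn (by simp)⟩
  -- `τ` is the transition map from the preferred chart to a foliation chart.
  let τ := ψ ∘ φ.symm
  let O := φ.target ∩ φ.symm ⁻¹' (U ∩ ψ.source)
  have hO : IsOpen O := φ.isOpen_inter_preimage_symm (hU.inter ψ.open_source)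
  have hmem : ∀ y ∈ φ.source, φ y ∈ O ↔ y ∈ U ∩ ψ.source := fun y hy => by
    simp [O, φ.left_inv hy, φ.map_source hy]
  have hτ : ContDiffOn ℝ ∞ τ O := by
    rw [← contMDiffOn_iff_contDiffOn]
    have h2 : ContMDiffOn (𝓡 m) (𝓡 m) ∞ φ.symm φ.target := contMDiffOn_chart_symm
    exact hψs.comp (h2.mono inter_subset_left) fun z hz => hz.2.2
  have hdτ : ∀ y ∈ φ.source, φ y ∈ O → ∀ v : TangentSpace (𝓡 m) y,
      mfderiv (𝓡 m) (𝓡 m) ψ y v = fderiv ℝ τ (φ y) (dChart x y v) := by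
    intro y hy hyO v
    refine mfderiv_eq_fderiv_dChart hy
      ((hτ.contDiffAt (hO.mem_nhds hyO)).differentiableAt (by simp)) ?_ v
    filter_upwards [φ.open_source.mem_nhds hy] with p hp
    exact congrArg ψ (φ.left_inv hp).symm
  have hsub : ∀ z ∈ O, ∃ y ∈ φ.source, φ y = z := fun z hz =>
    ⟨φ.symm z, φ.map_target hz.1, φ.right_inv hz.1⟩
  have hα : ContDiffOn ℝ ∞ (η.inChart x) O :=
    (hη.smooth.contDiffOn_inChart hU x).mono fun z hz => ⟨hz.1, hz.2.1⟩
  have hτ' : ∀ z ∈ O, ∀ v, fderiv ℝ τ z v = 0 → v = 0 := by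
    intro z hz u hu
    obtain ⟨y, hy, rfl⟩ := hsub z hz
    obtain ⟨v, rfl⟩ := dChart_surjective hy u
    have h0 : v = 0 := (injective_iff_map_eq_zero
      (mfderiv (𝓡 m) (𝓡 m) ψ y : EuclideanSpace ℝ (Fin m) →L[ℝ] EuclideanSpace ℝ (Fin m))).1
      (hψd.mfderiv_injective ((hmem y hy).1 hz).2) v ((hdτ y hy hz v).trans hu)
    rw [h0, map_zero]
  have hWα : ∀ z ∈ O, ∀ v, fderiv ℝ τ z v ∈ W → η.inChart x z v = 0 := by
    intro z hz u hu
    obtain ⟨y, hy, rfl⟩ := hsub z hz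
    obtain ⟨v, rfl⟩ := dChart_surjective hy u
    have hyU := (hmem y hy).1 hz
    have h1 : v ∈ V y := (hW y hyU.2 v).2 ((hdτ y hy hz v).symm ▸ hu)
    have h2 := hDV.le y h1
    rw [hD y hyU.1] at h2
    exact (η.inChart_dChart hy v).trans h2
  have hdimW : Module.finrank ℝ W = n * k := by
    rw [← hDV.regular.rank_eq x (mem_univ x)]
    have h1 : V x = W.comap (hψd.mfderiv hxψ).toLinearEquiv.toLinearMap :=
      Submodule.ext fun v => hW x hxψ v
    rw [h1]
    exact (finrank_comap_equiv (hψd.mfderiv hxψ).toLinearEquiv W).symm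
  have hdim := hDV.dim_eq
  obtain ⟨Φ, h1, h2, h3, h4, h5⟩ := exists_jet_coordinates (A := EuclideanSpace ℝ (Fin n)) hO
    ((hmem x hxφ).2 ⟨hxU, hxψ⟩) hα hτ hτ' hWα (by simpa using hdimW)
    (by
      rw [hdimW]
      simp only [finrank_euclideanSpace_fin]
      nlinarith)
    (fun b => by
      obtain ⟨v, rfl⟩ := hη.surjective hxU b
      exact ⟨_, η.inChart_dChart hxφ v⟩)
    (fun u hu huw => by
      obtain ⟨v, rfl⟩ := dChart_surjective hxφ u
      have h0 : v = 0 := hη.nondegenerate hxU ((η.inChart_dChart hxφ v).symm.trans hu)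
        fun w hw => by
          refine (η.extD_apply x v w).trans ?_
          exact sub_eq_zero.2 (huw _ ((η.inChart_dChart hxφ w).trans hw))
      rw [h0, map_zero])
  refine ⟨Φ, h1, fun z hz => (h2 hz).1, h3, h4, fun y hy hyΦ v => ?_⟩
  have hyU := (hmem y hy).1 (h2 hyΦ)
  obtain ⟨h6, h7⟩ := h5 _ hyΦ (dChart x y v)
  constructor
  · rw [← h6, hD y hyU.1]
    exact Iff.of_eq (congrArg (· = 0) (η.inChart_dChart hy v).symm)
  · rw [← h7, hW y hyU.2 v, hdτ y hy (h2 hyΦ) v]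
    rfl

end Main

theorem mainTheorem3 (n k m : ℕ) (hn : 1 ≤ n) (hk : 1 ≤ k)
    (M : Type*) [TopologicalSpace M] [T2Space M] [ChartedSpace (EuclideanSpace ℝ (Fin m)) M]
    [IsManifold (𝓡 m) ∞ M]
    (D V : TangentDistribution m M) (hDV : IsPolarisedKContact n k D V) :
    ∃ (N F Y : Type)
      (_ : TopologicalSpace N) (_ : ChartedSpace (EuclideanSpace ℝ (Fin n)) N)
      (_ : IsManifold (𝓡 n) ∞ N) (_ : T2Space N) (_ : SecondCountableTopology N)
      (_ : ConnectedSpace N)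
      (_ : TopologicalSpace F) (_ : ChartedSpace (EuclideanSpace ℝ (Fin k)) F)
      (_ : IsManifold (𝓡 k) ∞ F) (_ : T2Space F) (_ : SecondCountableTopology F)
      (_ : ConnectedSpace F)
      (_ : TopologicalSpace Y)
      (_ : ChartedSpace (EuclideanSpace ℝ (Fin n) × EuclideanSpace ℝ (Fin k)) Y)
      (_ : IsManifold 𝓘(ℝ, EuclideanSpace ℝ (Fin n) × EuclideanSpace ℝ (Fin k)) ∞ Y)
      (_ : T2Space Y) (_ : SecondCountableTopology Y) (_ : ConnectedSpace Y)
      (b : SmoothFibreBundle (EuclideanSpace ℝ (Fin n)) (EuclideanSpace ℝ (Fin k)) N F Y),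
      ∀ x : M, ∃ Φ : OpenPartialHomeomorph M (Jet1 b), x ∈ Φ.source ∧
        ContMDiffOn (𝓡 m) 𝓘(ℝ, (EuclideanSpace ℝ (Fin n) × EuclideanSpace ℝ (Fin k)) ×
          (EuclideanSpace ℝ (Fin n) →L[ℝ] EuclideanSpace ℝ (Fin k))) ∞ Φ Φ.source ∧
        ContMDiffOn 𝓘(ℝ, (EuclideanSpace ℝ (Fin n) × EuclideanSpace ℝ (Fin k)) ×
          (EuclideanSpace ℝ (Fin n) →L[ℝ] EuclideanSpace ℝ (Fin k))) (𝓡 m) ∞ Φ.symm Φ.target ∧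
        ∀ y ∈ Φ.source, ∀ v : TangentSpace (𝓡 m) y,
          (v ∈ D y ↔ mfderiv (𝓡 m) 𝓘(ℝ, (EuclideanSpace ℝ (Fin n) × EuclideanSpace ℝ (Fin k)) ×
            (EuclideanSpace ℝ (Fin n) →L[ℝ] EuclideanSpace ℝ (Fin k))) Φ y v ∈
              (Φ y).cartan) ∧
          (v ∈ V y ↔ mfderiv (𝓡 m) 𝓘(ℝ, (EuclideanSpace ℝ (Fin n) × EuclideanSpace ℝ (Fin k)) ×
            (EuclideanSpace ℝ (Fin n) →L[ℝ] EuclideanSpace ℝ (Fin k))) Φ y v ∈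
              (Φ y).vertical) := by
  let b := SmoothFibreBundle.trivial (EuclideanSpace ℝ (Fin n)) (EuclideanSpace ℝ (Fin k))
  refine ⟨EuclideanSpace ℝ (Fin n), EuclideanSpace ℝ (Fin k),
    EuclideanSpace ℝ (Fin n) × EuclideanSpace ℝ (Fin k), inferInstance, inferInstance,
    inferInstance, inferInstance, inferInstance, inferInstance, inferInstance, inferInstance,
    inferInstance, inferInstance, inferInstance, inferInstance, inferInstance, inferInstance,
    inferInstance, inferInstance, inferInstance, inferInstance, b, fun x => ?_⟩
  let φ := chartAt (EuclideanSpace ℝ (Fin m)) x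
  let J := SmoothFibreBundle.trivial.jetChart (EuclideanSpace ℝ (Fin n)) (EuclideanSpace ℝ (Fin k))
  have hJs : J.source = univ := SmoothFibreBundle.trivial.jetChart_source _ _
  have hJt : J.target = univ := SmoothFibreBundle.trivial.jetChart_target _ _
  have hJ := SmoothFibreBundle.trivial.jetChart_mem_maximalAtlas
    (EuclideanSpace ℝ (Fin n)) (EuclideanSpace ℝ (Fin k))
  obtain ⟨Φ, hxΦ, -, hΦ, hΦ', hΦDV⟩ := hDV.exists_coordinates x
  have hφ : ContMDiffOn (𝓡 m) (𝓡 m) ∞ φ φ.source := contMDiffOn_chart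
  have hφ' : ContMDiffOn (𝓡 m) (𝓡 m) ∞ φ.symm φ.target := contMDiffOn_chart_symm
  let Ψ : OpenPartialHomeomorph M (Jet1 b) := φ.trans (Φ.trans J.symm)
  have hΨs : ∀ y ∈ Ψ.source, y ∈ φ.source ∧ φ y ∈ Φ.source := fun y hy => ⟨hy.1, hy.2.1⟩
  have hΨ : ContMDiffOn (𝓡 m) 𝓘(ℝ, (EuclideanSpace ℝ (Fin n) × EuclideanSpace ℝ (Fin k)) ×
      (EuclideanSpace ℝ (Fin n) →L[ℝ] EuclideanSpace ℝ (Fin k))) ∞ Ψ Ψ.source :=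
    (contMDiffOn_symm_of_mem_maximalAtlas hJ).comp
      (hΦ.contMDiffOn.comp (hφ.mono fun y hy => (hΨs y hy).1) fun y hy => (hΨs y hy).2)
      fun y hy => hy.2.2
  refine ⟨Ψ, ⟨mem_chart_source _ x, hxΦ, by simp [hJt]⟩, hΨ, ?_, fun y hy v => ?_⟩
  · exact hφ'.comp (hΦ'.contMDiffOn.comp ((contMDiffOn_of_mem_maximalAtlas hJ).mono
      fun j _ => by rw [hJs]; exact mem_univ j) fun j hj => hj.1.2) fun j hj => hj.2
  · obtain ⟨hyφ, hyΦ⟩ := hΨs y hy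
    have hJΨ : ∀ p, J (Ψ p) = Φ (φ p) := fun p => J.right_inv (by rw [hJt]; exact mem_univ _)
    have hd : SmoothFibreBundle.trivial.dJetChart (Ψ y) (mfderiv (𝓡 m)
        𝓘(ℝ, (EuclideanSpace ℝ (Fin n) × EuclideanSpace ℝ (Fin k)) ×
          (EuclideanSpace ℝ (Fin n) →L[ℝ] EuclideanSpace ℝ (Fin k))) Ψ y v) =
        fderiv ℝ Φ (φ y) (dChart x y v) := by
      rw [← mfderiv_eq_fderiv_dChart (f := J ∘ Ψ) hyφ
        ((hΦ.contDiffAt (Φ.open_source.mem_nhds hyΦ)).differentiableAt (by simp))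
        (Filter.Eventually.of_forall hJΨ)]
      exact (congrArg (fun T : EuclideanSpace ℝ (Fin m) →L[ℝ] _ => T v)
        (mfderiv_comp y (SmoothFibreBundle.trivial.mdifferentiableAt_jetChart (Ψ y))
          ((hΨ.contMDiffAt (Ψ.open_source.mem_nhds hy)).mdifferentiableAt (by simp)))).symm
    obtain ⟨h1, h2⟩ := hΦDV y hyφ hyΦ v
    have h3 : (SmoothFibreBundle.trivial.jetChart _ _ (Ψ y)).2 = (Φ (φ y)).2 :=
      congrArg Prod.snd (hJΨ y)
    exact ⟨h1.trans (by rw [SmoothFibreBundle.trivial.mem_cartan_iff, hd, h3]),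
      h2.trans (by rw [SmoothFibreBundle.trivial.mem_vertical_iff, hd])⟩
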